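/- **Setting.** Let $n\ge1$, $N\ge 1$, $p_1,\dots,p_N\ge 0$ be integers, $p=\sum_i p_i$, and $0<\theta<\alpha<1$. Let $D_o\in\mathrm O(n)$ and $Y_i=D_oX_i$, where the entries of all the random matrices $X_i\in\mathbb R^{n\times p_i}$, $i\in[N]$, are i.i.d. Bernoulli-Gaussian $\mathrm{BG}(\theta)$, i.e. of law $(1-\theta)\delta_0+\theta\,\mathcal N(0,1)$. Put $X=[X_1,\dots,X_N]$ and $Y=[Y_1,\dots,Y_N]$. $\|\cdot\|_F$ is the Frobenius norm, $\sigma_n$ the smallest singular value of an $n\times n$ matrix, and $M^{\circ3}$ the entrywise cube. A matrix $Q$ is called an SVD projection of $M\in\mathbb R^{n\times n}$ if $Q=UV^{\mathsf T}$ for some singular value decomposition $M=U\Sigma V^{\mathsf T}$. Let $A^{(t)},A_1^{(t)},\dots,A_N^{(t)}\in\mathrm O(n)$ be the (fixed, non-random) current iterates of the centralized algorithm MSP and of its decentralized variant DMSP, and let $\partial A=4(A^{(t)}Y)^{\circ3}Y^{\mathsf T}$, $\partial A_i=4(A_i^{(t)}Y_i)^{\circ3}Y_i^{\mathsf T}$.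 The next iterates are as follows. * $A^{(t+1)}$ is an SVD projection of $\partial A$. * $A_i^{(t+1)}$ is an SVD projection of $G_i^{(T_c)}$, where $G_i^{(0)}=\partial A_i$ and $G_i^{(s+1)}=\sum_j w_{i,j}^{(s+1)}G_j^{(s)}$. The number $T_c$ of consensus iterations may depend on the data. The weights satisfy $w_{i,j}^{(s)}\ge0$ and $\sum_i w_{i,j}^{(s)}=1$, with $w^{(s)}_{i,j}>0$ iff $j=i$ or $(j,i)$ is an edge of the graph $\mathcal G^{(s)}$; the sequence $(\mathcal G^{(s)})_s$ of directed graphs on $[N]$ is uniformly strongly connected, i.e. for some integer $b\ge1$ the union of $\mathcal G^{(kb)},\dots,\mathcal G^{((k+1)b-1)}$ is strongly connected for every $k>0$. * $\bar A^{(t+1)}$, the result of perfect consensus, is an SVD projection of $\frac1N\sum_i\partial A_i$. Let $$\delta^{(s)}=\max_i\|A^{(s)}-A_i^{(s)}\|_F\quad(s=t,t+1),\qquad \delta_c^{(t+1)}=\max_i\|A_i^{(t+1)}-\bar A^{(t+1)}\|_F,$$ and assume $\delta^{(t)}>0$. Put $U=A^{(t)}D_o$, $U_i=A_i^{(t)}D_o$,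 $B=(UX)^{\circ3}X^{\mathsf T}$, $B_i=(U_iX_i)^{\circ3}X_i^{\mathsf T}$ and $$R=\frac{2\|B-\sum_iB_i\|_F}{\sigma_n(B)+\sigma_n(\sum_iB_i)}.$$ **Theorem.** There is an absolute constant $K>0$ such that the following holds for every constant $c_2>6.8\times10^4$. Suppose that, for some signed permutation matrix $P$ and some $$0\le\epsilon<\frac{\alpha-\theta}{2\alpha n(1-\theta)+3\sqrt2(1+\alpha)(1-\theta)+\alpha\theta},$$ we have $\|U-P\|_F\le\epsilon$ and $\|U_i-P\|_F\le\epsilon$ for all $i\in[N]$. Let $$C=6\alpha\theta(1-\theta)(1-2n\epsilon)-6(1-\alpha)\theta^2-6\alpha\theta^2\epsilon-18\sqrt2(\alpha+1)\theta(1-\theta)\epsilon ,$$ which is positive, and suppose that $$\frac p{(\ln p)^4}\ \ge\ K\,\frac{\delta^{(t)}+2}{\delta^{(t)}C}\,n$$ (that is, $p/(\ln p)^4=\omega\big(\tfrac{\delta^{(t)}+2}{\delta^{(t)}C}n\big)$ suffices). Suppose finally that, almost surely, whenever $\sigma_n(B)+\sigma_n(\sum_iB_i)>0$ and $R<\alpha\delta^{(t)}$,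 we have $$\delta_c^{(t+1)}\in\big[0,\ \alpha\delta^{(t)}-R\big).$$ Then $$\mathbb P\big(\delta^{(t+1)}<\alpha\delta^{(t)}\big)\ \ge\ 1-8np\theta\exp\Big(-\frac{(\ln p)^2}2\Big)-8n^2\exp\left(\frac{-3p\,(\delta^{(t)})^2C^2}{c_2(\delta^{(t)}+2)^2n^2\theta+16n^{5/2}(\ln p)^4\,\delta^{(t)}(\delta^{(t)}+2)\,C}\right).$$ -/

import Mathlib

open MeasureTheory ProbabilityTheory
open scoped Matrix Matrix.Norms.Frobenius

namespace DMSP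

noncomputable section

/-- The Bernoulli-Gaussian law `BG(θ)`: the law of `b * g` with `b ~ Bernoulli(θ)` and
`g ~ N(0,1)` independent, i.e. `(1 - θ) δ₀ + θ N(0,1)`. -/
def bernoulliGaussian (θ : ℝ) : Measure ℝ :=
  ENNReal.ofReal (1 - θ) • Measure.dirac 0 + ENNReal.ofReal θ • gaussianReal 0 1

/-- The entries of all the local matrices `X i` (of size `n × p i`) are i.i.d. `BG(θ)`. -/
def IsIIDBernoulliGaussian {Ω : Type*} [MeasurableSpace Ω] (μ : Measure Ω) {n N : ℕ}
    {p : Fin N → ℕ} (θ : ℝ) (X : (i : Fin N) → Ω → Matrix (Fin n) (Fin (p i)) ℝ) : Prop :=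
  (∀ i j k, HasLaw (fun ω => X i ω j k) (bernoulliGaussian θ) μ) ∧
    iIndepFun (fun (q : Σ i : Fin N, Fin n × Fin (p i)) ω => X q.1 ω q.2.1 q.2.2) μ

/-- The concatenation `[Y₁, …, Y_N]` of the local matrices; its columns are indexed by pairs
(node, local column). -/
def concat {n N : ℕ} {p : Fin N → ℕ} (Y : (i : Fin N) → Matrix (Fin n) (Fin (p i)) ℝ) :
    Matrix (Fin n) (Σ i : Fin N, Fin (p i)) ℝ :=
  Matrix.of fun j q => Y q.1 j q.2

/-- `(A Y)^{∘3} Yᵀ`, where `^{∘3}` is the entrywise third power. -/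
def cubeGram {n : ℕ} {κ : Type*} [Fintype κ] (A : Matrix (Fin n) (Fin n) ℝ)
    (Y : Matrix (Fin n) κ ℝ) : Matrix (Fin n) (Fin n) ℝ :=
  (A * Y).map (fun x => x ^ 3) * Yᵀ

/-- The gradient `∂A = 4 (A Y)^{∘3} Yᵀ`. -/
def grad {n : ℕ} {κ : Type*} [Fintype κ] (A : Matrix (Fin n) (Fin n) ℝ)
    (Y : Matrix (Fin n) κ ℝ) : Matrix (Fin n) (Fin n) ℝ :=
  (4 : ℝ) • cubeGram A Y

/-- `Q` is a possible output `U Vᵀ` for some singular value decomposition `M = U Σ Vᵀ`. -/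
def IsSVDProjection {n : ℕ} (M Q : Matrix (Fin n) (Fin n) ℝ) : Prop :=
  ∃ U ∈ Matrix.orthogonalGroup (Fin n) ℝ, ∃ V ∈ Matrix.orthogonalGroup (Fin n) ℝ,
    ∃ s : Fin n → ℝ, (∀ i, 0 ≤ s i) ∧ M = U * Matrix.diagonal s * Vᵀ ∧ Q = U * Vᵀ

/-- One iteration of the centralized algorithm MSP from `A` on the data `Y` can give `A'`. -/
def IsMSPStep {n : ℕ} {κ : Type*} [Fintype κ] (Y : Matrix (Fin n) κ ℝ)
    (A A' : Matrix (Fin n) (Fin n) ℝ) : Prop :=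
  IsSVDProjection (grad A Y) A'

/-- A sequence of directed graphs on the nodes (`E s i j`: `i` can send to `j` at inner
iteration `s`) is uniformly strongly connected: for some `b > 0`, each union over a window
`s = k b, …, (k + 1) b - 1` with `k > 0` is strongly connected. -/
def UniformlyStronglyConnected {N : ℕ} (E : ℕ → Fin N → Fin N → Prop) : Prop :=
  ∃ b : ℕ, 0 < b ∧ ∀ k : ℕ, 0 < k → ∀ i j : Fin N,
    Relation.ReflTransGen (fun u v => ∃ s, k * b ≤ s ∧ s < (k + 1) * b ∧ E s u v) i j

/-- Weighted adjacency matrices: column stochastic, and `w_{i,j} > 0` exactly if `j` is an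
in-neighbour of `i` (every node is its own in-neighbour). -/
def IsWeights {N : ℕ} (E : ℕ → Fin N → Fin N → Prop) (W : ℕ → Matrix (Fin N) (Fin N) ℝ) : Prop :=
  ∀ s, (∀ i j, 0 ≤ W s i j) ∧ (∀ j, ∑ i, W s i j = 1) ∧ ∀ i j, 0 < W s i j ↔ (E s j i ∨ j = i)

/-- The matrices held by the nodes after a number of consensus averaging iterations.
Weights vanish outside the in-neighbourhood, so the sum may run over all nodes. -/
def consensus {n N : ℕ} (W : ℕ → Matrix (Fin N) (Fin N) ℝ)
    (G : Fin N → Matrix (Fin n) (Fin n) ℝ) : ℕ → Fin N → Matrix (Fin n) (Fin n) ℝ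
  | 0 => G
  | s + 1 => fun i => ∑ j, W (s + 1) i j • consensus W G s j

/-- One outer iteration of the decentralized algorithm DMSP, with `Tc` consensus averaging
iterations, from the local dictionaries `A i` on the local data `Y i`, can give `A' i`. -/
def IsDMSPStep {n N : ℕ} {p : Fin N → ℕ} (W : ℕ → Matrix (Fin N) (Fin N) ℝ) (Tc : ℕ)
    (Y : (i : Fin N) → Matrix (Fin n) (Fin (p i)) ℝ)
    (A A' : Fin N → Matrix (Fin n) (Fin n) ℝ) : Prop :=
  ∀ i, IsSVDProjection (consensus W (fun j => grad (A j) (Y j)) Tc i) (A' i)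

/-- The outcome of an outer DMSP iteration with perfect consensus, i.e. when every node
obtains the average of the local gradients. -/
def IsPerfectDMSPStep {n N : ℕ} {p : Fin N → ℕ}
    (Y : (i : Fin N) → Matrix (Fin n) (Fin (p i)) ℝ)
    (A : Fin N → Matrix (Fin n) (Fin n) ℝ) (Abar : Matrix (Fin n) (Fin n) ℝ) : Prop :=
  IsSVDProjection ((N : ℝ)⁻¹ • ∑ i, grad (A i) (Y i)) Abar

/-- `max_i ‖A - A_i‖_F` (used for at least one node). -/
def deviation {n N : ℕ} (A : Matrix (Fin n) (Fin n) ℝ)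
    (Ai : Fin N → Matrix (Fin n) (Fin n) ℝ) : ℝ :=
  ⨆ i, ‖A - Ai i‖

/-- Signed permutation matrices. -/
def IsSignedPermutation {n : ℕ} (P : Matrix (Fin n) (Fin n) ℝ) : Prop :=
  ∃ (π : Equiv.Perm (Fin n)) (s : Fin n → ℝ), (∀ i, s i = 1 ∨ s i = -1) ∧
    ∀ i j, P i j = if j = π i then s i else 0

/-- The smallest singular value `σ_n` of an `n × n` matrix (singular values in Mathlib are
listed in decreasing order, starting from index `0`). -/
def sigmaMin {n : ℕ} (M : Matrix (Fin n) (Fin n) ℝ) : ℝ :=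
  (Matrix.toEuclideanLin M).singularValues (n - 1)

/-- The ratio `2 ‖M - M'‖_F / (σ_n(M) + σ_n(M'))`. -/
def polarRatio {n : ℕ} (M M' : Matrix (Fin n) (Fin n) ℝ) : ℝ :=
  2 * ‖M - M'‖ / (sigmaMin M + sigmaMin M')

/-- The constant `C`. -/
def constC (n : ℕ) (α θ ε : ℝ) : ℝ :=
  6 * α * θ * (1 - θ) * (1 - 2 * n * ε) - 6 * (1 - α) * θ ^ 2 - 6 * α * θ ^ 2 * ε
    - 18 * √2 * (α + 1) * θ * (1 - θ) * ε

/-- The lower bound on the probability. -/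
def probBound (n p : ℕ) (θ δ C c₂ : ℝ) : ℝ :=
  1 - 8 * n * p * θ * Real.exp (-(Real.log p) ^ 2 / 2)
    - 8 * (n : ℝ) ^ 2 * Real.exp
        (-3 * p * δ ^ 2 * C ^ 2 /
          (c₂ * (δ + 2) ^ 2 * (n : ℝ) ^ 2 * θ
            + 16 * (n : ℝ) ^ (5 / 2 : ℝ) * (Real.log p) ^ 4 * δ * (δ + 2) * C))

end

end DMSP

/-! Write `B` and `S` for the centralized Gram matrix and the sum of the local ones. SVD projections
ignore positive scaling and commute with right multiplication by an orthogonal matrix, so the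
centralized and the perfect-consensus iterates, times `D₀`, are polar factors of `B` and `S`. Polar
factors obey `‖Q - Q'‖ ≤ polarRatio M M'` (`IsSVDProjection.norm_sub_le_polarRatio`). By the
triangle inequality and the assumption on the consensus error, the contraction holds as soon as
`polarRatio (B ω) (S ω) < α * δ`, and it remains to show that this is likely.

`B` and `S` concentrate around p·m(U) and Σ pᵢ m(Uᵢ), where m(U) = 3θ(1-θ)U^{∘3} + 3θ²U is
`meanCubeGram`. At a signed permutation m(P) = 3θP, whose singular values all equal 3θ. Among
orthogonal matrices ε-close to P, m is Lipschitz with the small constant c = 9√2θ(1-θ)ε + 3θ²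
(`norm_cube_sub_cube_le`). So the ratio of the means is at most about cδ/(3θ - cε), and `constC`
measures how far this lies below αδ; the resulting room for random error is computed in
`polarRatio_lt_of_norm_sub_mean_le`.

Each Gram entry is a sum of independent column contributions. Truncating the data at T = ln p makes
them bounded, costs a Gaussian tail exp(-T²/2), and shifts the mean by O(e^{-T}) = O(1/p), which the
sample size condition absorbs. Bernstein's inequality with second moment at most 105θ and bound
n^{3/2}T⁴, followed by a union bound over entries (`measure_gram_deviation_le`), gives the
probability. -/

namespace DMSP

/-! ### Frobenius norm, smallest singular value, polar factors. -/

section LinearAlgebra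

variable {n : ℕ}

lemma norm_sq_eq_sum (M : Matrix (Fin n) (Fin n) ℝ) : ‖M‖ ^ 2 = ∑ i, ∑ j, M i j ^ 2 := by
  rw [Matrix.frobenius_norm_def, ← Real.sqrt_eq_rpow, Real.sq_sqrt (by positivity)]
  simp

lemma trace_transpose_mul (M N : Matrix (Fin n) (Fin n) ℝ) :
    (Mᵀ * N).trace = ∑ i, ∑ j, M i j * N i j := by
  simp only [Matrix.trace, Matrix.diag, Matrix.mul_apply, Matrix.transpose_apply]
  exact Finset.sum_comm

lemma norm_sq_eq_trace (M : Matrix (Fin n) (Fin n) ℝ) : ‖M‖ ^ 2 = (Mᵀ * M).trace := by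
  rw [norm_sq_eq_sum, trace_transpose_mul]
  simp only [sq]

lemma trace_transpose_mul_le (M N : Matrix (Fin n) (Fin n) ℝ) :
    (Mᵀ * N).trace ≤ ‖M‖ * ‖N‖ := by
  refine le_of_sq_le_sq ?_ (by positivity)
  rw [mul_pow, norm_sq_eq_sum, norm_sq_eq_sum, trace_transpose_mul]
  simp only [← Finset.sum_product']
  exact Finset.sum_mul_sq_le_sq_mul_sq _ _ _

lemma norm_le_of_abs_le (M : Matrix (Fin n) (Fin n) ℝ) {a : ℝ} (ha : 0 ≤ a)
    (h : ∀ i j, |M i j| ≤ a) : ‖M‖ ≤ n * a := by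
  refine abs_le_of_sq_le_sq' ?_ (by positivity) |>.2
  rw [norm_sq_eq_sum]
  calc ∑ i, ∑ j, M i j ^ 2 ≤ ∑ _i : Fin n, ∑ _j : Fin n, a ^ 2 :=
        Finset.sum_le_sum fun i _ => Finset.sum_le_sum fun j _ => sq_le_sq' (abs_le.1 (h i j)).1
          (abs_le.1 (h i j)).2
    _ = (n * a) ^ 2 := by simp; ring

lemma orthogonal_transpose_mul {D : Matrix (Fin n) (Fin n) ℝ}
    (hD : D ∈ Matrix.orthogonalGroup (Fin n) ℝ) : Dᵀ * D = 1 :=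
  (Matrix.mem_orthogonalGroup_iff' (Fin n) ℝ).1 hD

lemma orthogonal_mul_transpose {D : Matrix (Fin n) (Fin n) ℝ}
    (hD : D ∈ Matrix.orthogonalGroup (Fin n) ℝ) : D * Dᵀ = 1 :=
  (Matrix.mem_orthogonalGroup_iff (Fin n) ℝ).1 hD

lemma transpose_mem_orthogonalGroup {D : Matrix (Fin n) (Fin n) ℝ}
    (hD : D ∈ Matrix.orthogonalGroup (Fin n) ℝ) : Dᵀ ∈ Matrix.orthogonalGroup (Fin n) ℝ := by
  rw [Matrix.mem_orthogonalGroup_iff]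
  exact orthogonal_transpose_mul hD

lemma norm_mul_orthogonal (M : Matrix (Fin n) (Fin n) ℝ) {D : Matrix (Fin n) (Fin n) ℝ}
    (hD : D ∈ Matrix.orthogonalGroup (Fin n) ℝ) : ‖M * D‖ = ‖M‖ := by
  refine (sq_eq_sq₀ (norm_nonneg _) (norm_nonneg _)).1 ?_
  rw [norm_sq_eq_trace, norm_sq_eq_trace, Matrix.transpose_mul, Matrix.trace_mul_comm,
    Matrix.mul_assoc, ← Matrix.mul_assoc D, orthogonal_mul_transpose hD, Matrix.one_mul,
    Matrix.trace_mul_comm]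

lemma sum_row_sq_of_orthogonal {D : Matrix (Fin n) (Fin n) ℝ}
    (hD : D ∈ Matrix.orthogonalGroup (Fin n) ℝ) (i : Fin n) : ∑ j, D i j ^ 2 = 1 := by
  have := congrFun (congrFun (orthogonal_mul_transpose hD) i) i
  simpa [Matrix.mul_apply, sq] using this

lemma apply_le_one_of_orthogonal {D : Matrix (Fin n) (Fin n) ℝ}
    (hD : D ∈ Matrix.orthogonalGroup (Fin n) ℝ) (i j : Fin n) : |D i j| ≤ 1 := by
  rw [← sq_le_one_iff_abs_le_one, ← sum_row_sq_of_orthogonal hD i]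
  exact Finset.single_le_sum (f := fun j => D i j ^ 2) (fun _ _ => sq_nonneg _) (Finset.mem_univ j)

lemma norm_sq_sub_of_orthogonal {Q Q' : Matrix (Fin n) (Fin n) ℝ}
    (hQ : Q ∈ Matrix.orthogonalGroup (Fin n) ℝ) (hQ' : Q' ∈ Matrix.orthogonalGroup (Fin n) ℝ) :
    ‖Q - Q'‖ ^ 2 = 2 * (n - (Q'ᵀ * Q).trace) := by
  have h : (Qᵀ * Q').trace = (Q'ᵀ * Q).trace := by
    rw [← Matrix.trace_transpose, Matrix.transpose_mul, Matrix.transpose_transpose]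
  rw [norm_sq_eq_trace, Matrix.transpose_sub, Matrix.sub_mul, Matrix.mul_sub, Matrix.mul_sub,
    orthogonal_transpose_mul hQ, orthogonal_transpose_mul hQ']
  simp only [Matrix.trace_sub, Matrix.trace_one, Fintype.card_fin, h]
  ring

lemma toEuclideanLin_norm_sq (M : Matrix (Fin n) (Fin n) ℝ) (x : EuclideanSpace ℝ (Fin n)) :
    ‖Matrix.toEuclideanLin M x‖ ^ 2 = ∑ i, (∑ j, M i j * x j) ^ 2 := by
  rw [EuclideanSpace.norm_sq_eq]
  simp [Matrix.toLpLin_apply, Matrix.mulVec, dotProduct]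

lemma sigmaMin_nonneg (M : Matrix (Fin n) (Fin n) ℝ) : 0 ≤ sigmaMin M :=
  LinearMap.singularValues_nonneg _ _

/-- In an eigenbasis of T*T one has ‖Tx‖² = Σ λᵢxᵢ², and σ_n² is the last, hence least, eigenvalue.
-/
lemma sigmaMin_mul_norm_le (M : Matrix (Fin n) (Fin n) ℝ) (x : EuclideanSpace ℝ (Fin n)) :
    sigmaMin M * ‖x‖ ≤ ‖Matrix.toEuclideanLin M x‖ := by
  obtain rfl | hn := Nat.eq_zero_or_pos n
  · simp [Subsingleton.elim x 0]
  refine abs_le_of_sq_le_sq' ?_ (norm_nonneg _) |>.2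
  set T := Matrix.toEuclideanLin M with hT
  have hS := T.isSymmetric_adjoint_comp_self
  have hfr : Module.finrank ℝ (EuclideanSpace ℝ (Fin n)) = n := by simp
  set b := hS.eigenvectorBasis hfr with hb
  have h1 : sigmaMin M ^ 2 = hS.eigenvalues hfr ⟨n - 1, by omega⟩ :=
    T.sq_singularValues_of_lt hfr (by omega)
  have h2 : ‖T x‖ ^ 2 = ∑ i, hS.eigenvalues hfr i * (b.repr x i) ^ 2 := by
    rw [← real_inner_self_eq_norm_sq, ← LinearMap.adjoint_inner_left,
      ← b.sum_inner_mul_inner]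
    refine Finset.sum_congr rfl fun i _ => ?_
    have := hS.eigenvectorBasis_apply_self_apply hfr x i
    simp only [LinearMap.comp_apply] at this
    rw [real_inner_comm, ← b.repr_apply_apply, ← b.repr_apply_apply, hb, this]
    simp
    ring
  rw [mul_pow, h1, h2, ← b.repr.norm_map x, EuclideanSpace.norm_sq_eq, Finset.mul_sum]
  refine Finset.sum_le_sum fun i _ => ?_
  rw [Real.norm_eq_abs, sq_abs]
  refine mul_le_mul_of_nonneg_right (hS.eigenvalues_antitone hfr ?_) (sq_nonneg _)
  exact Fin.le_def.2 (by simp; omega)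

/-- Converse half of the variational description: σ_n is attained on an eigenvector of T*T. -/
lemma le_sigmaMin (hn : 0 < n) (M : Matrix (Fin n) (Fin n) ℝ) {c : ℝ}
    (h : ∀ x : EuclideanSpace ℝ (Fin n), c * ‖x‖ ≤ ‖Matrix.toEuclideanLin M x‖) :
    c ≤ sigmaMin M := by
  set T := Matrix.toEuclideanLin M with hT
  have hfr : Module.finrank ℝ (EuclideanSpace ℝ (Fin n)) = n := by simp
  obtain ⟨v, hv⟩ := (T.hasEigenvalue_adjoint_comp_self_sq_singularValues
    (n := n - 1) (by rw [hfr]; omega)).exists_hasEigenvector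
  have hv0 : 0 < ‖v‖ := norm_pos_iff.2 hv.2
  have h1 : ‖T v‖ ^ 2 = (sigmaMin M * ‖v‖) ^ 2 := by
    rw [← real_inner_self_eq_norm_sq, ← LinearMap.adjoint_inner_left]
    have := hv.apply_eq_smul
    simp only [LinearMap.comp_apply] at this
    rw [this, real_inner_smul_left, real_inner_self_eq_norm_sq, mul_pow]
    rfl
  have h2 : ‖T v‖ = sigmaMin M * ‖v‖ :=
    (sq_eq_sq₀ (norm_nonneg _) (mul_nonneg (sigmaMin_nonneg M) hv0.le)).1 h1
  exact le_of_mul_le_mul_right ((h v).trans h2.le) hv0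

lemma norm_toEuclideanLin_le (M : Matrix (Fin n) (Fin n) ℝ) (x : EuclideanSpace ℝ (Fin n)) :
    ‖Matrix.toEuclideanLin M x‖ ≤ ‖M‖ * ‖x‖ := by
  refine abs_le_of_sq_le_sq' ?_ (by positivity) |>.2
  rw [mul_pow, toEuclideanLin_norm_sq, norm_sq_eq_sum, EuclideanSpace.norm_sq_eq, Finset.sum_mul]
  simp only [Real.norm_eq_abs, sq_abs]
  exact Finset.sum_le_sum fun i _ => Finset.sum_mul_sq_le_sq_mul_sq _ _ _

lemma IsSignedPermutation.norm_apply {P : Matrix (Fin n) (Fin n) ℝ} (hP : IsSignedPermutation P)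
    (x : EuclideanSpace ℝ (Fin n)) : ‖Matrix.toEuclideanLin P x‖ = ‖x‖ := by
  obtain ⟨π, s, hs, hP⟩ := hP
  refine (sq_eq_sq₀ (norm_nonneg _) (norm_nonneg _)).1 ?_
  rw [toEuclideanLin_norm_sq, EuclideanSpace.norm_sq_eq]
  simp only [hP, ite_mul, zero_mul, Finset.sum_ite_eq', Finset.mem_univ, if_true,
    Real.norm_eq_abs, sq_abs]
  rw [← Equiv.sum_comp π fun j => x j ^ 2]
  refine Finset.sum_congr rfl fun i _ => ?_
  rcases hs i with h | h <;> rw [h] <;> ring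

/-- Weyl's inequality at a multiple of an isometry: ‖Mx‖ ≥ c‖Px‖ - ‖(M - cP)x‖, and ‖Px‖ = ‖x‖. -/
lemma IsSignedPermutation.sub_norm_le_sigmaMin (hn : 0 < n) {P : Matrix (Fin n) (Fin n) ℝ}
    (hP : IsSignedPermutation P) {c : ℝ} (hc : 0 ≤ c) (M : Matrix (Fin n) (Fin n) ℝ) :
    c - ‖M - c • P‖ ≤ sigmaMin M := by
  refine le_sigmaMin hn M fun x => ?_
  have h1 := norm_toEuclideanLin_le (M - c • P) x
  have h2 : Matrix.toEuclideanLin M x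
      = c • Matrix.toEuclideanLin P x - (-Matrix.toEuclideanLin (M - c • P) x) := by
    simp
  have h3 := norm_sub_norm_le (c • Matrix.toEuclideanLin P x)
    (-Matrix.toEuclideanLin (M - c • P) x)
  rw [← h2, norm_neg, norm_smul, hP.norm_apply, Real.norm_of_nonneg hc] at h3
  linarith

/-- The smallest singular value is at most every entry of `Σ` in a decomposition `U Σ Vᵀ`. -/
lemma sigmaMin_le_of_svd {U V : Matrix (Fin n) (Fin n) ℝ}
    (hU : U ∈ Matrix.orthogonalGroup (Fin n) ℝ) (hV : V ∈ Matrix.orthogonalGroup (Fin n) ℝ)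
    {s : Fin n → ℝ} (hs : ∀ i, 0 ≤ s i) (k : Fin n) :
    sigmaMin (U * Matrix.diagonal s * Vᵀ) ≤ s k := by
  have hUc : ∑ i, U i k ^ 2 = 1 := by
    have := congrFun (congrFun (orthogonal_transpose_mul hU) k) k
    simpa [Matrix.mul_apply, sq] using this
  have hVc : ∑ i, V i k ^ 2 = 1 := by
    have := congrFun (congrFun (orthogonal_transpose_mul hV) k) k
    simpa [Matrix.mul_apply, sq] using this
  -- The k-th right singular vector is a unit test vector with image of length `s k`.
  set x : EuclideanSpace ℝ (Fin n) := WithLp.toLp 2 fun i => V i k with hx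
  have h1 : ‖x‖ = 1 := by
    refine (sq_eq_sq₀ (norm_nonneg _) zero_le_one).1 ?_
    rw [EuclideanSpace.norm_sq_eq]
    simpa [hx] using hVc
  have h2 : ‖Matrix.toEuclideanLin (U * Matrix.diagonal s * Vᵀ) x‖ = s k := by
    refine (sq_eq_sq₀ (norm_nonneg _) (hs k)).1 ?_
    rw [toEuclideanLin_norm_sq]
    have h3 : ∀ i, ∑ j, (U * Matrix.diagonal s * Vᵀ) i j * x j = s k * U i k := by
      intro i
      change (U * Matrix.diagonal s * Vᵀ * V) i k = _
      rw [Matrix.mul_assoc, orthogonal_transpose_mul hV, Matrix.mul_one, Matrix.mul_diagonal]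
      ring
    simp only [h3, mul_pow, ← Finset.mul_sum, hUc, mul_one]
  have := sigmaMin_mul_norm_le (U * Matrix.diagonal s * Vᵀ) x
  rwa [h1, h2, mul_one] at this

lemma IsSVDProjection.mem_orthogonalGroup {M Q : Matrix (Fin n) (Fin n) ℝ}
    (h : IsSVDProjection M Q) : Q ∈ Matrix.orthogonalGroup (Fin n) ℝ := by
  obtain ⟨U, hU, V, hV, s, -, -, rfl⟩ := h
  exact mul_mem hU (transpose_mem_orthogonalGroup hV)

/-- The polar factor `Q` of `M` maximizes `⟨Q', M⟩` over orthogonal `Q'`, quantitatively. -/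
lemma IsSVDProjection.sigmaMin_mul_norm_sq_le {M Q Q' : Matrix (Fin n) (Fin n) ℝ}
    (h : IsSVDProjection M Q) (hQ' : Q' ∈ Matrix.orthogonalGroup (Fin n) ℝ) :
    sigmaMin M * ‖Q - Q'‖ ^ 2 ≤ 2 * ((Q - Q')ᵀ * M).trace := by
  have hQ := h.mem_orthogonalGroup
  obtain ⟨U, hU, V, hV, s, hs, hM, hQe⟩ := h
  -- In terms of G the trace is Σ sᵢ(1 - Gᵢᵢ) and ‖Q - Q'‖² is 2Σ(1 - Gᵢᵢ). The comparison is then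
  -- termwise, from σ_n ≤ sᵢ and Gᵢᵢ ≤ 1.
  set G := Vᵀ * Q'ᵀ * U with hG
  have hGo : G ∈ Matrix.orthogonalGroup (Fin n) ℝ :=
    mul_mem (mul_mem (transpose_mem_orthogonalGroup hV) (transpose_mem_orthogonalGroup hQ')) hU
  have h1 : (Qᵀ * M).trace = ∑ i, s i := by
    rw [hQe, hM, Matrix.transpose_mul, Matrix.transpose_transpose, Matrix.mul_assoc,
      Matrix.mul_assoc U, ← Matrix.mul_assoc Uᵀ, orthogonal_transpose_mul hU, Matrix.one_mul,
      Matrix.trace_mul_comm, Matrix.mul_assoc, orthogonal_transpose_mul hV, Matrix.mul_one,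
      Matrix.trace_diagonal]
  have h2 : (Q'ᵀ * M).trace = ∑ i, G i i * s i := by
    rw [hM, ← Matrix.mul_assoc, Matrix.trace_mul_comm, ← Matrix.mul_assoc, ← Matrix.mul_assoc,
      ← hG]
    simp [Matrix.trace, Matrix.mul_diagonal]
  have h3 : (Q'ᵀ * Q).trace = ∑ i, G i i := by
    rw [hQe, ← Matrix.mul_assoc, Matrix.trace_mul_comm, ← Matrix.mul_assoc, ← hG]
    rfl
  rw [norm_sq_sub_of_orthogonal hQ hQ', h3, Matrix.transpose_sub, Matrix.sub_mul,
    Matrix.trace_sub, h1, h2, ← Finset.sum_sub_distrib]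
  have h4 : (n : ℝ) - ∑ i, G i i = ∑ i, (1 - G i i) := by simp
  rw [h4, mul_left_comm, Finset.mul_sum]
  refine mul_le_mul_of_nonneg_left (Finset.sum_le_sum fun i _ => ?_) zero_le_two
  have h5 : sigmaMin M ≤ s i := hM ▸ sigmaMin_le_of_svd hU hV hs i
  have h6 := (abs_le.1 (apply_le_one_of_orthogonal hGo i i)).2
  nlinarith

/-- Perturbation bound for the orthogonal polar factor. -/
lemma IsSVDProjection.norm_sub_le_polarRatio {M M' Q Q' : Matrix (Fin n) (Fin n) ℝ}
    (h : IsSVDProjection M Q) (h' : IsSVDProjection M' Q')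
    (hpos : 0 < sigmaMin M + sigmaMin M') : ‖Q - Q'‖ ≤ polarRatio M M' := by
  have h1 := h.sigmaMin_mul_norm_sq_le h'.mem_orthogonalGroup
  have h2 := h'.sigmaMin_mul_norm_sq_le h.mem_orthogonalGroup
  have h3 := trace_transpose_mul_le (Q - Q') (M - M')
  have h4 : ((Q' - Q)ᵀ * M').trace = -((Q - Q')ᵀ * M').trace := by
    rw [← neg_sub Q Q', Matrix.transpose_neg, Matrix.neg_mul, Matrix.trace_neg]
  rw [norm_sub_rev, h4] at h2
  rw [Matrix.mul_sub, Matrix.trace_sub] at h3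
  rw [polarRatio, le_div_iff₀ hpos]
  -- Adding `h1` and `h2` gives (σ + σ')‖Q - Q'‖² ≤ 2⟨Q - Q', M - M'⟩. Cauchy–Schwarz (`h3`) bounds
  -- the right side, and one factor ‖Q - Q'‖ cancels if nonzero.
  rcases (norm_nonneg (Q - Q')).eq_or_lt with h0 | h0
  · rw [← h0]; simp
  · refine le_of_mul_le_mul_left ?_ h0
    nlinarith

/-- Polar factors are unchanged under positive scaling and are equivariant under right
multiplication by orthogonal matrices. -/
lemma IsSVDProjection.mul_orthogonal {M Q D : Matrix (Fin n) (Fin n) ℝ} {c : ℝ} (hc : 0 < c)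
    (hD : D ∈ Matrix.orthogonalGroup (Fin n) ℝ) (h : IsSVDProjection (c • (M * Dᵀ)) Q) :
    IsSVDProjection M (Q * D) := by
  obtain ⟨U, hU, V, hV, s, hs, hM, hQ⟩ := h
  refine ⟨U, hU, Dᵀ * V, mul_mem (transpose_mem_orthogonalGroup hD) hV, fun i => c⁻¹ * s i,
    fun i => mul_nonneg (inv_nonneg.2 hc.le) (hs i), ?_, ?_⟩
  · have h1 : M = c⁻¹ • ((c • (M * Dᵀ)) * D) := by
      rw [Matrix.smul_mul, Matrix.mul_assoc, orthogonal_transpose_mul hD, Matrix.mul_one, smul_smul,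
        inv_mul_cancel₀ hc.ne', one_smul]
    have h2 : Matrix.diagonal (fun i => c⁻¹ * s i) = c⁻¹ • Matrix.diagonal s := by
      rw [← Matrix.diagonal_smul]; rfl
    rw [h1, hM, h2, Matrix.transpose_mul, Matrix.transpose_transpose, Matrix.mul_smul,
      Matrix.smul_mul, Matrix.mul_assoc _ Vᵀ D]
  · rw [hQ, Matrix.transpose_mul, Matrix.transpose_transpose, Matrix.mul_assoc]

end LinearAlgebra

/-! ### The mean map near a signed permutation, and the ratio for matrices close to their means. -/

section Deterministic

variable {n : ℕ}

/-- The gain of a factor ε has two sources. Off the support of P entries are at most ε, so cubing is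
3ε²-Lipschitz there. On the support cubing is only 3-Lipschitz, but because rows have unit length
the entries of U and V differ there by at most ε times the distance of the rows. Each source
contributes 9ε² to the square (3√2ε)² = 18ε². -/
lemma norm_cube_sub_cube_le {U V P : Matrix (Fin n) (Fin n) ℝ}
    (hU : U ∈ Matrix.orthogonalGroup (Fin n) ℝ) (hV : V ∈ Matrix.orthogonalGroup (Fin n) ℝ)
    (hP : IsSignedPermutation P) {ε : ℝ} (hε : 0 ≤ ε) (hε1 : ε ≤ 1)
    (hUP : ‖U - P‖ ≤ ε) (hVP : ‖V - P‖ ≤ ε) :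
    ‖U.map (fun x => x ^ 3) - V.map (fun x => x ^ 3)‖ ≤ 3 * √2 * ε * ‖U - V‖ := by
  obtain ⟨π, s, hs, hP⟩ := hP
  have hrow : ∀ W : Matrix (Fin n) (Fin n) ℝ, ‖W - P‖ ≤ ε → ∀ i, ∑ j, (W i j - P i j) ^ 2 ≤ ε ^ 2 := by
    intro W hW i
    calc ∑ j, (W i j - P i j) ^ 2 ≤ ∑ i, ∑ j, (W - P) i j ^ 2 :=
          Finset.single_le_sum (f := fun i => ∑ j, (W - P) i j ^ 2)
            (fun _ _ => Finset.sum_nonneg fun _ _ => sq_nonneg _) (Finset.mem_univ i)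
      _ = ‖W - P‖ ^ 2 := (norm_sq_eq_sum _).symm
      _ ≤ ε ^ 2 := by gcongr
  -- Unit rows make the entry on the support an affine function of the squared distance to P.
  have hexp : ∀ W ∈ Matrix.orthogonalGroup (Fin n) ℝ, ∀ i,
      ∑ j, (W i j - P i j) ^ 2 = 2 - 2 * (s i * W i (π i)) := by
    intro W hW i
    have h1 : ∀ j, (W i j - P i j) ^ 2
        = W i j ^ 2 + if j = π i then (1 - 2 * (s i * W i j)) else 0 := by
      intro j
      rw [hP]
      rcases hs i with h | h <;> simp only [h] <;> split_ifs <;> ring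
    simp only [h1, Finset.sum_add_distrib, sum_row_sq_of_orthogonal hW, Finset.sum_ite_eq',
      Finset.mem_univ, if_true]
    ring
  have hoff : ∀ W : Matrix (Fin n) (Fin n) ℝ, ‖W - P‖ ≤ ε → ∀ i j, j ≠ π i → |W i j| ≤ ε := by
    intro W hW i j hj
    refine abs_le_of_sq_le_sq ?_ hε
    refine le_trans ?_ (hrow W hW i)
    refine le_trans (le_of_eq ?_) (Finset.single_le_sum (f := fun j => (W i j - P i j) ^ 2)
      (fun _ _ => sq_nonneg _) (Finset.mem_univ j))
    simp [hP, hj]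
  have hon : ∀ i, (U i (π i) - V i (π i)) ^ 2 ≤ ε ^ 2 * ∑ j, (U i j - V i j) ^ 2 := by
    intro i
    -- A difference of two squared distances to P, factored as a difference of squares so that
    -- Cauchy–Schwarz produces ‖U - V‖ times O(ε).
    have h1 : 2 * (s i * (V i (π i) - U i (π i)))
        = ∑ j, (U i j - V i j) * ((U i j - P i j) + (V i j - P i j)) := by
      have : ∀ j, (U i j - V i j) * ((U i j - P i j) + (V i j - P i j))
          = (U i j - P i j) ^ 2 - (V i j - P i j) ^ 2 := fun j => by ring
      simp only [this, Finset.sum_sub_distrib, hexp U hU, hexp V hV]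
      ring
    have h2 := Finset.sum_mul_sq_le_sq_mul_sq Finset.univ (fun j => U i j - V i j)
      (fun j => (U i j - P i j) + (V i j - P i j))
    have h3 : ∑ j, ((U i j - P i j) + (V i j - P i j)) ^ 2 ≤ 4 * ε ^ 2 := by
      calc ∑ j, ((U i j - P i j) + (V i j - P i j)) ^ 2
          ≤ ∑ j, (2 * (U i j - P i j) ^ 2 + 2 * (V i j - P i j) ^ 2) :=
            Finset.sum_le_sum fun j _ => by
              nlinarith [sq_nonneg ((U i j - P i j) - (V i j - P i j))]
        _ ≤ 4 * ε ^ 2 := by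
            rw [Finset.sum_add_distrib, ← Finset.mul_sum, ← Finset.mul_sum]
            linarith [hrow U hUP i, hrow V hVP i]
    rw [← h1] at h2
    have h4 := mul_le_mul_of_nonneg_left h3
      (Finset.sum_nonneg fun j (_ : j ∈ Finset.univ) => sq_nonneg (U i j - V i j))
    have h5 : (2 * (s i * (V i (π i) - U i (π i)))) ^ 2 = 4 * (U i (π i) - V i (π i)) ^ 2 := by
      rcases hs i with h | h <;> rw [h] <;> ring
    rw [h5] at h2
    linarith
  have hcube : ∀ a b c : ℝ, |a| ≤ c → |b| ≤ c →
      (a ^ 3 - b ^ 3) ^ 2 ≤ (3 * c ^ 2) ^ 2 * (a - b) ^ 2 := by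
    intro a b c ha hb
    have h1 : (a ^ 3 - b ^ 3) ^ 2 = (a ^ 2 + a * b + b ^ 2) ^ 2 * (a - b) ^ 2 := by ring
    rw [h1]
    have ha2 : a ^ 2 ≤ c ^ 2 := sq_le_sq' (abs_le.1 ha).1 (abs_le.1 ha).2
    have hb2 : b ^ 2 ≤ c ^ 2 := sq_le_sq' (abs_le.1 hb).1 (abs_le.1 hb).2
    gcongr
    · nlinarith [sq_nonneg (a + b), sq_nonneg a, sq_nonneg b]
    · nlinarith [sq_nonneg (a - b)]
  have hmain : ∀ i, ∑ j, (U i j ^ 3 - V i j ^ 3) ^ 2 ≤ 18 * ε ^ 2 * ∑ j, (U i j - V i j) ^ 2 := by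
    intro i
    have h1 : ∀ j, (U i j ^ 3 - V i j ^ 3) ^ 2 ≤ 9 * ε ^ 2 * (U i j - V i j) ^ 2
        + if j = π i then 9 * (U i j - V i j) ^ 2 else 0 := by
      intro j
      split_ifs with hj
      · have := hcube _ _ _ (apply_le_one_of_orthogonal hU i j) (apply_le_one_of_orthogonal hV i j)
        have h0 : 0 ≤ 9 * ε ^ 2 * (U i j - V i j) ^ 2 := by positivity
        linarith
      · refine (hcube _ _ _ (hoff U hUP i j hj) (hoff V hVP i j hj)).trans ?_
        rw [add_zero]
        gcongr
        nlinarith [pow_le_one₀ hε hε1 (n := 2), sq_nonneg ε]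
    refine (Finset.sum_le_sum fun j _ => h1 j).trans ?_
    simp only [Finset.sum_add_distrib, ← Finset.mul_sum, Finset.sum_ite_eq', Finset.mem_univ,
      if_true]
    linarith [hon i]
  refine abs_le_of_sq_le_sq' ?_ (by positivity) |>.2
  rw [mul_pow, norm_sq_eq_sum, norm_sq_eq_sum, Finset.mul_sum]
  have h2 : (3 * √2 * ε) ^ 2 = 18 * ε ^ 2 := by
    rw [mul_pow, mul_pow, Real.sq_sqrt zero_le_two]; ring
  rw [h2]
  exact Finset.sum_le_sum fun i _ => hmain i

/-- The mean of `(U x)^{∘3} xᵀ` for a vector `x` with i.i.d. `BG(θ)` entries. -/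
noncomputable def meanCubeGram (θ : ℝ) (U : Matrix (Fin n) (Fin n) ℝ) :
    Matrix (Fin n) (Fin n) ℝ :=
  (3 * θ * (1 - θ)) • U.map (fun x => x ^ 3) + (3 * θ ^ 2) • U

lemma norm_meanCubeGram_sub_le {θ : ℝ} (hθ : 0 ≤ θ) (hθ1 : θ ≤ 1)
    {U V P : Matrix (Fin n) (Fin n) ℝ}
    (hU : U ∈ Matrix.orthogonalGroup (Fin n) ℝ) (hV : V ∈ Matrix.orthogonalGroup (Fin n) ℝ)
    (hP : IsSignedPermutation P) {ε : ℝ} (hε : 0 ≤ ε) (hε1 : ε ≤ 1)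
    (hUP : ‖U - P‖ ≤ ε) (hVP : ‖V - P‖ ≤ ε) :
    ‖meanCubeGram θ U - meanCubeGram θ V‖
      ≤ (9 * √2 * θ * (1 - θ) * ε + 3 * θ ^ 2) * ‖U - V‖ := by
  have h : meanCubeGram θ U - meanCubeGram θ V
      = (3 * θ * (1 - θ)) • (U.map (fun x => x ^ 3) - V.map (fun x => x ^ 3))
        + (3 * θ ^ 2) • (U - V) := by
    simp only [meanCubeGram, smul_sub]; abel
  have h1 : 0 ≤ 3 * θ * (1 - θ) := mul_nonneg (by positivity) (by linarith)
  rw [h]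
  refine (norm_add_le _ _).trans ?_
  rw [norm_smul, norm_smul, Real.norm_of_nonneg h1, Real.norm_of_nonneg (by positivity)]
  have := mul_le_mul_of_nonneg_left (norm_cube_sub_cube_le hU hV hP hε hε1 hUP hVP) h1
  linarith

lemma IsSignedPermutation.mem_orthogonalGroup {P : Matrix (Fin n) (Fin n) ℝ}
    (hP : IsSignedPermutation P) : P ∈ Matrix.orthogonalGroup (Fin n) ℝ := by
  obtain ⟨π, s, hs, hP⟩ := hP
  rw [Matrix.mem_orthogonalGroup_iff]
  ext i j
  change ∑ k, P i k * P j k = _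
  simp only [hP, ite_mul, zero_mul, Finset.sum_ite_eq', Finset.mem_univ, if_true, Matrix.one_apply,
    π.injective.eq_iff]
  by_cases h : i = j
  · subst h
    rcases hs i with h | h <;> simp [h]
  · simp [h]

lemma IsSignedPermutation.meanCubeGram {P : Matrix (Fin n) (Fin n) ℝ}
    (hP : IsSignedPermutation P) (θ : ℝ) : meanCubeGram θ P = (3 * θ) • P := by
  obtain ⟨π, s, hs, hP⟩ := hP
  ext i j
  simp only [DMSP.meanCubeGram, Matrix.add_apply, Matrix.smul_apply, Matrix.map_apply, hP,
    smul_eq_mul]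
  rcases hs i with h | h <;> simp only [h] <;> split_ifs <;> ring

lemma constC_pos {θ α ε : ℝ} (hθ : 0 < θ) (hθα : θ < α) (hα : α < 1)
    (hε : ε < (α - θ) / (2 * α * n * (1 - θ) + 3 * √2 * (1 + α) * (1 - θ) + α * θ)) :
    0 < constC n α θ ε := by
  have hα0 : 0 < α := hθ.trans hθα
  have h1 : 0 < 1 - θ := by linarith
  rw [lt_div_iff₀ (by positivity)] at hε
  -- C is exactly 6θ times (numerator minus ε times denominator) of the threshold for ε.
  have := mul_pos hθ (sub_pos.2 hε)
  rw [constC]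
  nlinarith

lemma eps_le_one {θ α ε : ℝ} (hn : 0 < n) (hθ : 0 < θ) (hθα : θ < α) (hα : α < 1)
    (hε : ε < (α - θ) / (2 * α * n * (1 - θ) + 3 * √2 * (1 + α) * (1 - θ) + α * θ)) :
    ε ≤ 1 := by
  have hα0 : 0 < α := hθ.trans hθα
  have h1 : 0 < 1 - θ := by linarith
  refine hε.le.trans (div_le_one_of_le₀ ?_ (by positivity))
  have hn1 : (1 : ℝ) ≤ n := by exact_mod_cast hn
  have h2 : α * 1 * (1 - θ) ≤ α * n * (1 - θ) := by gcongr
  have h3 : 0 ≤ α * n * (1 - θ) := by positivity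
  have h4 : 0 ≤ 3 * √2 * (1 + α) * (1 - θ) := by positivity
  have h5 : 0 ≤ α * θ := by positivity
  nlinarith

/-- If both Gram matrices are close to their means, their polar factors are close. -/
lemma polarRatio_lt_of_norm_sub_mean_le (hn : 0 < n) {N : ℕ} {p : Fin N → ℕ}
    (hp : 0 < ∑ i, p i) {θ α ε δ : ℝ} (hθ : 0 < θ) (hθα : θ < α) (hα : α < 1)
    {U P : Matrix (Fin n) (Fin n) ℝ} {V : Fin N → Matrix (Fin n) (Fin n) ℝ}
    (hU : U ∈ Matrix.orthogonalGroup (Fin n) ℝ) (hV : ∀ i, V i ∈ Matrix.orthogonalGroup (Fin n) ℝ)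
    (hP : IsSignedPermutation P) (hε0 : 0 ≤ ε)
    (hε : ε < (α - θ) / (2 * α * n * (1 - θ) + 3 * √2 * (1 + α) * (1 - θ) + α * θ))
    (hUP : ‖U - P‖ ≤ ε) (hVP : ∀ i, ‖V i - P‖ ≤ ε) (hδ : 0 < δ) (hUV : ∀ i, ‖U - V i‖ ≤ δ)
    {B S : Matrix (Fin n) (Fin n) ℝ} {r : ℝ}
    (hr : r = (∑ i, p i : ℕ) * (δ * constC n α θ ε) / (2 * (δ + 2)))
    (hB : ‖B - ∑ i, (p i : ℝ) • meanCubeGram θ U‖ ≤ r)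
    (hS : ‖S - ∑ i, (p i : ℝ) • meanCubeGram θ (V i)‖ ≤ r) :
    0 < sigmaMin B + sigmaMin S ∧ polarRatio B S < α * δ := by
  have hα0 : 0 < α := hθ.trans hθα
  have hθ1 : 0 < 1 - θ := by linarith
  have hC := constC_pos hθ hθα hα hε
  have hε1 := eps_le_one hn hθ hθα hα hε
  set q : ℝ := ((∑ i, p i : ℕ) : ℝ) with hq
  have hq0 : 0 < q := Nat.cast_pos.2 hp
  have hqs : q = ∑ i, (p i : ℝ) := by rw [hq]; push_cast; rfl
  have hrpos : 0 < r := by rw [hr]; positivity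
  set c := 9 * √2 * θ * (1 - θ) * ε + 3 * θ ^ 2 with hc
  have hc0 : 0 ≤ c := by positivity
  have hsum : ∀ (W W' : Fin N → Matrix (Fin n) (Fin n) ℝ) (d : ℝ),
      (∀ i, ‖W i - W' i‖ ≤ d) →
      ‖∑ i, (p i : ℝ) • W i - ∑ i, (p i : ℝ) • W' i‖ ≤ q * d := by
    intro W W' d h
    rw [← Finset.sum_sub_distrib, hqs, Finset.sum_mul]
    refine (norm_sum_le _ _).trans (Finset.sum_le_sum fun i _ => ?_)
    rw [← smul_sub, norm_smul, Real.norm_of_nonneg (Nat.cast_nonneg _)]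
    exact mul_le_mul_of_nonneg_left (h i) (Nat.cast_nonneg _)
  have hPP : ‖P - P‖ ≤ ε := by simpa using hε0
  -- Weyl around q·3θ·P: the mean is within q·cε of it, and M within r of the mean.
  have hsig : ∀ (W : Fin N → Matrix (Fin n) (Fin n) ℝ) (M : Matrix (Fin n) (Fin n) ℝ),
      (∀ i, W i ∈ Matrix.orthogonalGroup (Fin n) ℝ) → (∀ i, ‖W i - P‖ ≤ ε) →
      ‖M - ∑ i, (p i : ℝ) • meanCubeGram θ (W i)‖ ≤ r →
      q * (3 * θ - c * ε) - r ≤ sigmaMin M := by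
    intro W M hW hWP hM
    have h1 := hsum (fun i => meanCubeGram θ (W i)) (fun _ => meanCubeGram θ P) (c * ε) fun i =>
      (norm_meanCubeGram_sub_le hθ.le (by linarith) (hW i) hP.mem_orthogonalGroup hP hε0 hε1
        (hWP i) hPP).trans (mul_le_mul_of_nonneg_left (hWP i) hc0)
    have h2 : ∑ i, (p i : ℝ) • meanCubeGram θ P = (q * (3 * θ)) • P := by
      rw [← Finset.sum_smul, ← hqs, hP.meanCubeGram, smul_smul]
    rw [h2] at h1
    have h3 := hP.sub_norm_le_sigmaMin hn (c := q * (3 * θ)) (by positivity) M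
    have h4 := norm_sub_le_norm_sub_add_norm_sub M
      (∑ i, (p i : ℝ) • meanCubeGram θ (W i)) ((q * (3 * θ)) • P)
    linarith
  have hsB := hsig (fun _ => U) B (fun _ => hU) (fun _ => hUP) hB
  have hsS := hsig V S hV hVP hS
  have hBS : ‖B - S‖ ≤ 2 * r + q * (c * δ) := by
    have h1 := hsum (fun _ => meanCubeGram θ U) (fun i => meanCubeGram θ (V i)) (c * δ) fun i =>
      (norm_meanCubeGram_sub_le hθ.le (by linarith) hU (hV i) hP hε0 hε1
        hUP (hVP i)).trans (mul_le_mul_of_nonneg_left (hUV i) hc0)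
    have h2 := norm_sub_le_norm_sub_add_norm_sub B
      (∑ i, (p i : ℝ) • meanCubeGram θ U) S
    have h3 := norm_sub_le_norm_sub_add_norm_sub (∑ i, (p i : ℝ) • meanCubeGram θ U)
      (∑ i, (p i : ℝ) • meanCubeGram θ (V i)) S
    rw [norm_sub_rev (∑ i, (p i : ℝ) • meanCubeGram θ (V i)) S] at h3
    linarith
  have hcε : c * ε ≤ 9 * √2 * θ * (1 - θ) * ε + 3 * θ ^ 2 * ε := by
    have : 0 ≤ 9 * √2 * θ * (1 - θ) * ε * (1 - ε) := by
      have : 0 ≤ 1 - ε := by linarith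
      positivity
    rw [hc]; nlinarith
  -- This identity is what fixes r. With error r in each matrix, 4r + 2qcδ must stay below 2αδ(q(3θ
  -- - cε) - r); since α < 1, it is enough that 4r + 2δr ≤ qδC.
  have hr2 : 2 * r * (δ + 2) = q * (δ * constC n α θ ε) := by rw [hr]; field_simp
  -- The term of C carrying nε is pure slack here; the other terms match after `hcε`, which uses ε²
  -- ≤ ε.
  have hCle : constC n α θ ε ≤ 2 * α * (3 * θ - c * ε) - 2 * c := by
    have h1 : 0 ≤ 12 * α * θ * (1 - θ) * n * ε := by positivity
    have h2 := mul_le_mul_of_nonneg_left hcε (by positivity : 0 ≤ 2 * α)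
    rw [constC]
    linarith
  have hkey : 2 * ‖B - S‖ < α * δ * (sigmaMin B + sigmaMin S) := by
    have h1 : α * δ * (2 * (q * (3 * θ - c * ε) - r)) ≤ α * δ * (sigmaMin B + sigmaMin S) :=
      mul_le_mul_of_nonneg_left (by linarith) (by positivity)
    have h2 : 0 < r * δ * (1 - α) := mul_pos (by positivity) (by linarith)
    have h3 := mul_le_mul_of_nonneg_left hCle (by positivity : 0 ≤ q * δ)
    nlinarith
  have hpos : 0 < sigmaMin B + sigmaMin S := by
    have : 0 < α * δ * (sigmaMin B + sigmaMin S) :=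
      lt_of_le_of_lt (by positivity) hkey
    exact (pos_iff_pos_of_mul_pos this).1 (by positivity)
  exact ⟨hpos, by rwa [polarRatio, div_lt_iff₀ hpos]⟩

end Deterministic

/-! ### Gaussian moments and truncated Bernoulli-Gaussian moments. -/

section Truncation

open Real

lemma integrable_pow_gaussianReal (k : ℕ) :
    Integrable (fun x : ℝ => x ^ k) (gaussianReal 0 1) := by
  have h := (memLp_id_gaussianReal' (μ := 0) (v := 1) k (by simp)).integrable_norm_pow'
  exact h.mono' (by fun_prop) (.of_forall fun x => by simp)

/-- Integration by parts: the density φ satisfies (-φ)' = xφ. -/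
lemma integral_pow_add_two_gaussianReal (k : ℕ) :
    ∫ x, x ^ (k + 2) ∂gaussianReal 0 1 = (k + 1) * ∫ x, x ^ k ∂gaussianReal 0 1 := by
  have hint : ∀ j : ℕ, Integrable (fun x : ℝ => gaussianPDFReal 0 1 x * x ^ j) := by
    intro j
    have := integrable_pow_gaussianReal j
    rw [gaussianReal_of_var_ne_zero _ one_ne_zero, integrable_withDensity_iff_integrable_smul'
      (measurable_gaussianPDF 0 1) (.of_forall fun _ => gaussianPDF_lt_top)] at this
    simpa [gaussianPDF, ENNReal.toReal_ofReal, gaussianPDFReal_nonneg] using this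
  have hderiv : ∀ x : ℝ, HasDerivAt (fun x => -gaussianPDFReal 0 1 x)
      (x * gaussianPDFReal 0 1 x) x := by
    intro x
    have h1 : HasDerivAt (fun x : ℝ => -(x - 0) ^ 2 / (2 * ((1 : NNReal) : ℝ))) (-x) x := by
      have := (((hasDerivAt_id x).sub_const 0).pow 2).neg.div_const (2 * ((1 : NNReal) : ℝ))
      refine this.congr_deriv ?_
      simp
      ring
    have := ((h1.exp).const_mul (√(2 * π * ((1 : NNReal) : ℝ)))⁻¹).neg
    refine this.congr_deriv ?_
    rw [gaussianPDFReal]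
    ring
  rw [integral_gaussianReal_eq_integral_smul one_ne_zero,
    integral_gaussianReal_eq_integral_smul one_ne_zero]
  have h := integral_mul_deriv_eq_deriv_mul_of_integrable
    (u := fun x : ℝ => x ^ (k + 1)) (v := fun x => -gaussianPDFReal 0 1 x)
    (u' := fun x => (k + 1) * x ^ k) (v' := fun x => x * gaussianPDFReal 0 1 x)
    (fun x _ => by simpa using hasDerivAt_pow (k + 1) x) (fun x _ => hderiv x)
    ((hint (k + 2)).congr (.of_forall fun x => by simp only [Pi.mul_apply]; ring))
    (((hint k).const_mul (-((k : ℝ) + 1))).congr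
      (.of_forall fun x => by simp only [Pi.mul_apply]; ring))
    ((hint (k + 1)).neg.congr (.of_forall fun x => by simp only [Pi.mul_apply, Pi.neg_apply]; ring))
  simp only [smul_eq_mul]
  rw [← integral_const_mul]
  calc ∫ x, gaussianPDFReal 0 1 x * x ^ (k + 2)
      = ∫ x, x ^ (k + 1) * (x * gaussianPDFReal 0 1 x) := by congr 1; ext x; ring
    _ = _ := by rw [h, ← integral_neg]; congr 1; ext x; ring

lemma integral_sq_gaussianReal : ∫ x, x ^ 2 ∂gaussianReal 0 1 = 1 := by
  simpa using integral_pow_add_two_gaussianReal 0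

lemma integral_pow_four_gaussianReal : ∫ x, x ^ 4 ∂gaussianReal 0 1 = 3 := by
  rw [integral_pow_add_two_gaussianReal 2, integral_sq_gaussianReal]; norm_num

lemma integral_pow_six_gaussianReal : ∫ x, x ^ 6 ∂gaussianReal 0 1 = 15 := by
  rw [integral_pow_add_two_gaussianReal 4, integral_pow_four_gaussianReal]; norm_num

lemma integral_pow_eight_gaussianReal : ∫ x, x ^ 8 ∂gaussianReal 0 1 = 105 := by
  rw [integral_pow_add_two_gaussianReal 6, integral_pow_six_gaussianReal]; norm_num

/-- Truncation at level `T`. -/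
noncomputable def trunc (T x : ℝ) : ℝ := if |x| ≤ T then x else 0

lemma trunc_of_le {T x : ℝ} (h : |x| ≤ T) : trunc T x = x := if_pos h

lemma abs_trunc_le {T : ℝ} (hT : 0 ≤ T) (x : ℝ) : |trunc T x| ≤ T := by
  unfold trunc; split_ifs with h <;> simp [*]

lemma measurable_trunc (T : ℝ) : Measurable (trunc T) :=
  Measurable.ite (measurableSet_le measurable_abs measurable_const) measurable_id measurable_const

lemma trunc_neg (T x : ℝ) : trunc T (-x) = -trunc T x := by
  unfold trunc; rw [abs_neg]; split_ifs <;> simp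

lemma integrable_trunc_pow {T : ℝ} (hT : 0 ≤ T) (k : ℕ) (ν : Measure ℝ) [IsFiniteMeasure ν] :
    Integrable (fun x => trunc T x ^ k) ν := by
  refine Integrable.of_bound ((measurable_trunc T).pow_const k).aestronglyMeasurable (T ^ k)
    (.of_forall fun x => ?_)
  rw [norm_pow, norm_eq_abs]
  exact pow_le_pow_left₀ (abs_nonneg _) (abs_trunc_le hT x) k

lemma isProbabilityMeasure_bernoulliGaussian {θ : ℝ} (hθ : 0 ≤ θ) (hθ1 : θ ≤ 1) :
    IsProbabilityMeasure (bernoulliGaussian θ) := by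
  constructor
  simp only [bernoulliGaussian, Measure.coe_add, Measure.coe_smul, Pi.add_apply, Pi.smul_apply,
    measure_univ, smul_eq_mul, mul_one]
  rw [← ENNReal.ofReal_add (by linarith) hθ]
  simp

lemma integral_bernoulliGaussian {θ : ℝ} (hθ : 0 ≤ θ) (hθ1 : θ ≤ 1) {f : ℝ → ℝ}
    (hf : Integrable f (gaussianReal 0 1)) :
    ∫ x, f x ∂bernoulliGaussian θ = (1 - θ) * f 0 + θ * ∫ x, f x ∂gaussianReal 0 1 := by
  rw [bernoulliGaussian, integral_add_measure
    ((integrable_dirac (by simp)).smul_measure ENNReal.ofReal_ne_top)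
    (hf.smul_measure ENNReal.ofReal_ne_top),
    integral_smul_measure, integral_smul_measure, integral_dirac, ENNReal.toReal_ofReal hθ,
    ENNReal.toReal_ofReal (by linarith)]
  simp

/-- The moments of a truncated Bernoulli-Gaussian variable. -/
noncomputable def truncMoment (T θ : ℝ) (k : ℕ) : ℝ :=
  ∫ x, trunc T x ^ k ∂bernoulliGaussian θ

lemma truncMoment_eq {T θ : ℝ} (hT : 0 ≤ T) (hθ : 0 ≤ θ) (hθ1 : θ ≤ 1) {k : ℕ} (hk : k ≠ 0) :
    truncMoment T θ k = θ * ∫ x, trunc T x ^ k ∂gaussianReal 0 1 := by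
  rw [truncMoment, integral_bernoulliGaussian hθ hθ1 (integrable_trunc_pow hT k _)]
  simp [trunc, hk]

lemma truncMoment_odd {T θ : ℝ} (hT : 0 ≤ T) (hθ : 0 ≤ θ) (hθ1 : θ ≤ 1) {k : ℕ} (hk : Odd k) :
    truncMoment T θ k = 0 := by
  rw [truncMoment_eq hT hθ hθ1 (by rintro rfl; simp at hk)]
  have h : ∫ x, trunc T x ^ k ∂gaussianReal 0 1 = -∫ x, trunc T x ^ k ∂gaussianReal 0 1 := by
    have h1 := gaussianReal_map_neg (μ := 0) (v := 1)
    rw [neg_zero] at h1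
    conv_lhs => rw [← h1]
    rw [integral_map measurable_neg.aemeasurable
      ((measurable_trunc T).pow_const k).aestronglyMeasurable, ← integral_neg]
    simp only [trunc_neg, hk.neg_pow]
  have : ∫ x, trunc T x ^ k ∂gaussianReal 0 1 = 0 := by linarith
  rw [this, mul_zero]

lemma truncMoment_even_nonneg (T θ : ℝ) {k : ℕ} (hk : Even k) : 0 ≤ truncMoment T θ k :=
  integral_nonneg fun _ => hk.pow_nonneg _

lemma truncMoment_even_le {T θ : ℝ} (hT : 0 ≤ T) (hθ : 0 ≤ θ) (hθ1 : θ ≤ 1) {k : ℕ} (hk0 : k ≠ 0)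
    (hk : Even k) : truncMoment T θ k ≤ θ * ∫ x, x ^ k ∂gaussianReal 0 1 := by
  rw [truncMoment_eq hT hθ hθ1 hk0]
  refine mul_le_mul_of_nonneg_left (integral_mono (integrable_trunc_pow hT k _)
    (integrable_pow_gaussianReal k) fun x => ?_) hθ
  simp only [trunc]
  split_ifs
  · exact le_rfl
  · simpa [hk0] using hk.pow_nonneg x

/-- For |x| > T, x^k ≤ k! e^{|x|} ≤ k! e^{-T} e^{2|x|} ≤ k! e^{-T}(e^{2x} + e^{-2x}), and the
Gaussian moment generating function at ±2 is e². A loss of order e^{-T} is all that is needed, since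
T will be ln p. -/
lemma le_truncMoment_even {T θ : ℝ} (hT : 0 ≤ T) (hθ : 0 ≤ θ) (hθ1 : θ ≤ 1) {k : ℕ} (hk0 : k ≠ 0)
    (hk : Even k) :
    θ * ∫ x, x ^ k ∂gaussianReal 0 1 - θ * (2 * k.factorial * exp 2 * exp (-T))
      ≤ truncMoment T θ k := by
  rw [truncMoment_eq hT hθ hθ1 hk0, ← mul_sub]
  refine mul_le_mul_of_nonneg_left ?_ hθ
  have hexp : ∫ x, exp (-T) * k.factorial * (exp (2 * x) + exp (-2 * x)) ∂gaussianReal 0 1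
      = 2 * k.factorial * exp 2 * exp (-T) := by
    have h : ∀ t : ℝ, ∫ x, exp (t * x) ∂gaussianReal 0 1 = exp (t ^ 2 / 2) := by
      intro t
      have := congrFun (mgf_fun_id_gaussianReal (μ := 0) (v := 1)) t
      simpa [mgf] using this
    rw [integral_const_mul, integral_add (integrable_exp_mul_gaussianReal 2)
      (integrable_exp_mul_gaussianReal (-2)), h, h]
    norm_num
    ring
  have hi : Integrable (fun x => exp (-T) * k.factorial * (exp (2 * x) + exp (-2 * x)))
      (gaussianReal 0 1) :=
    ((integrable_exp_mul_gaussianReal 2).add (integrable_exp_mul_gaussianReal (-2))).const_mul _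
  rw [← hexp, sub_le_iff_le_add, ← integral_add (integrable_trunc_pow hT k _) hi]
  refine integral_mono (integrable_pow_gaussianReal k)
    ((integrable_trunc_pow hT k _).add hi) fun x => ?_
  simp only [trunc]
  split_ifs with h
  · have : 0 ≤ exp (-T) * k.factorial * (exp (2 * x) + exp (-2 * x)) := by positivity
    linarith
  · rw [zero_pow hk0, zero_add]
    have h1 : x ^ k ≤ k.factorial * exp |x| := by
      have := pow_div_factorial_le_exp |x| (abs_nonneg x) k
      rw [div_le_iff₀ (by positivity), hk.pow_abs] at this
      linarith
    have h2 : exp |x| ≤ exp (-T) * exp (2 * |x|) := by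
      rw [← exp_add]; exact exp_le_exp.2 (by linarith)
    have h3 : exp (2 * |x|) ≤ exp (2 * x) + exp (-2 * x) := by
      rcases abs_cases x with ⟨h, -⟩ | ⟨h, -⟩ <;> rw [h]
      · linarith [exp_pos (-2 * x)]
      · rw [show 2 * -x = -2 * x by ring]; linarith [exp_pos (2 * x)]
    calc x ^ k ≤ k.factorial * (exp (-T) * (exp (2 * x) + exp (-2 * x))) := by
          refine h1.trans ?_
          gcongr
          exact h2.trans (by gcongr)
      _ = _ := by ring

/-- The tail of the Bernoulli-Gaussian law. -/
lemma bernoulliGaussian_tail_le {T θ : ℝ} (hT : 0 ≤ T) (hθ : 0 ≤ θ) :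
    (bernoulliGaussian θ).real {x | T < |x|} ≤ 2 * θ * exp (-T ^ 2 / 2) := by
  have hg : (gaussianReal 0 1).real {x | T < |x|} ≤ 2 * exp (-T ^ 2 / 2) := by
    have h1 : {x : ℝ | T < |x|} ⊆ {x | T ≤ x} ∪ {x | x ≤ -T} := by
      intro x (hx : T < |x|)
      rcases lt_abs.1 hx with h | h
      · exact Or.inl h.le
      · exact Or.inr (show x ≤ -T by linarith)
    -- Chernoff with the optimal parameters ±T; the atom at 0 does not charge the tail.
    have h2 := measure_ge_le_exp_mul_mgf (X := fun x : ℝ => x) (μ := gaussianReal 0 1) T hT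
      (integrable_exp_mul_gaussianReal T)
    have h3 := measure_le_le_exp_mul_mgf (X := fun x : ℝ => x) (μ := gaussianReal 0 1) (-T)
      (neg_nonpos.2 hT) (integrable_exp_mul_gaussianReal (-T))
    rw [mgf_fun_id_gaussianReal, ← exp_add] at h2 h3
    have h4 : -T * T + (0 * T + ((1 : NNReal) : ℝ) * T ^ 2 / 2) = -T ^ 2 / 2 := by
      rw [NNReal.coe_one]; ring
    have h5 : -(-T) * -T + (0 * -T + ((1 : NNReal) : ℝ) * (-T) ^ 2 / 2) = -T ^ 2 / 2 := by
      rw [NNReal.coe_one]; ring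
    rw [h4] at h2
    rw [h5] at h3
    calc (gaussianReal 0 1).real {x | T < |x|}
        ≤ (gaussianReal 0 1).real ({x | T ≤ x} ∪ {x | x ≤ -T}) := measureReal_mono h1
      _ ≤ _ := (measureReal_union_le _ _).trans (by linarith)
  have h0 : (Measure.dirac (0 : ℝ)) {x | T < |x|} = 0 := by
    rw [Measure.dirac_apply' _ (measurableSet_lt measurable_const measurable_abs)]
    simp [hT]
  rw [Measure.real, bernoulliGaussian, Measure.add_apply, Measure.smul_apply, Measure.smul_apply,
    h0, smul_zero, zero_add, smul_eq_mul, ENNReal.toReal_mul, ENNReal.toReal_ofReal hθ]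
  have := mul_le_mul_of_nonneg_left hg hθ
  rw [Measure.real] at this
  linarith

end Truncation

/-! ### Moments of linear forms in independent bounded symmetric-type variables. -/

section ColumnMoments

variable {Ω : Type*} [MeasurableSpace Ω] {P : Measure Ω}

lemma integrable_of_abs_le [IsFiniteMeasure P] {f : Ω → ℝ} (hf : Measurable f) {c : ℝ} (h : ∀ ω, |f ω| ≤ c) :
    Integrable f P :=
  .of_bound hf.aestronglyMeasurable c (.of_forall h)

/-- Peels one variable off a linear form by the binomial theorem and independence; boundedness
supplies integrability. All moment computations below rest on it. -/
lemma integral_add_pow_mul_pow [IsProbabilityMeasure P] {f g : Ω → ℝ} (hf : Measurable f) (hg : Measurable g)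
    (hfg : IndepFun f g P) {a b : ℝ} (hfa : ∀ ω, |f ω| ≤ a) (hgb : ∀ ω, |g ω| ≤ b)
    (u : ℝ) (m l : ℕ) :
    ∫ ω, (f ω + u * g ω) ^ m * g ω ^ l ∂P
      = ∑ i ∈ Finset.range (m + 1),
        (m.choose i * u ^ (m - i)) * ((∫ ω, f ω ^ i ∂P) * ∫ ω, g ω ^ (m - i + l) ∂P) := by
  have hpow : ∀ {h : Ω → ℝ} {c : ℝ}, (∀ ω, |h ω| ≤ c) → ∀ (i : ℕ) ω, |h ω ^ i| ≤ c ^ i := by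
    intro h c hc i ω
    rw [abs_pow]
    exact pow_le_pow_left₀ (abs_nonneg _) (hc ω) i
  have hind : ∀ i j : ℕ, IndepFun (fun ω => f ω ^ i) (fun ω => g ω ^ j) P := fun i j =>
    hfg.comp (φ := fun x => x ^ i) (ψ := fun x => x ^ j) (by fun_prop) (by fun_prop)
  have hint : ∀ i j : ℕ, Integrable (fun ω => f ω ^ i * g ω ^ j) P := fun i j =>
    (hind i j).integrable_mul (integrable_of_abs_le (hf.pow_const i) (hpow hfa i))
      (integrable_of_abs_le (hg.pow_const j) (hpow hgb j))
  have hexp : ∀ ω, (f ω + u * g ω) ^ m * g ω ^ l = ∑ i ∈ Finset.range (m + 1),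
      (m.choose i * u ^ (m - i)) * (f ω ^ i * g ω ^ (m - i + l)) := by
    intro ω
    rw [add_pow, Finset.sum_mul]
    refine Finset.sum_congr rfl fun i _ => ?_
    rw [mul_pow, pow_add]
    ring
  simp only [hexp]
  rw [integral_finsetSum _ fun i _ => (hint i _).const_mul _]
  refine Finset.sum_congr rfl fun i _ => ?_
  rw [integral_const_mul, (hind i _).integral_fun_mul_eq_mul_integral
    (hf.pow_const i).aestronglyMeasurable (hg.pow_const _).aestronglyMeasurable]

/-- Independent bounded random variables with common moments `m`. -/
structure BoundedIndep {ι : Type*} (P : Measure Ω) (y : ι → Ω → ℝ) (T : ℝ) (m : ℕ → ℝ) :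
    Prop where
  measurable : ∀ k, Measurable (y k)
  indep : iIndepFun y P
  abs_le : ∀ k ω, |y k ω| ≤ T
  moment : ∀ k j, ∫ ω, y k ω ^ j ∂P = m j

namespace BoundedIndep

variable {ι : Type*} {y : ι → Ω → ℝ} {T : ℝ} {m : ℕ → ℝ}

lemma measurable_sum (hy : BoundedIndep P y T m) (u : ι → ℝ) (s : Finset ι) :
    Measurable fun ω => ∑ k ∈ s, u k * y k ω :=
  Finset.measurable_sum _ fun k _ => (hy.measurable k).const_mul _

lemma abs_sum_le (hy : BoundedIndep P y T m) (u : ι → ℝ) (s : Finset ι) (ω : Ω) :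
    |∑ k ∈ s, u k * y k ω| ≤ (∑ k ∈ s, |u k|) * T := by
  rw [Finset.sum_mul]
  refine (Finset.abs_sum_le_sum_abs _ _).trans (Finset.sum_le_sum fun k _ => ?_)
  rw [abs_mul]
  exact mul_le_mul_of_nonneg_left (hy.abs_le k ω) (abs_nonneg _)

/-- Cauchy–Schwarz with a unit vector u bounds the linear form by √n·T. -/
lemma abs_cube_mul_le [Fintype ι] (hy : BoundedIndep P y T m) (hT : 0 ≤ T)
    {u : ι → ℝ} (hu : ∑ k, u k ^ 2 = 1) (l : ι) (ω : Ω) :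
    |(∑ k, u k * y k ω) ^ 3 * y l ω| ≤ √(Fintype.card ι) ^ 3 * T ^ 4 := by
  have h1 : |∑ k, u k * y k ω| ≤ √(Fintype.card ι) * T := by
    refine abs_le_of_sq_le_sq ?_ (by positivity)
    rw [mul_pow, Real.sq_sqrt (Nat.cast_nonneg _)]
    calc (∑ k, u k * y k ω) ^ 2 ≤ (∑ k, u k ^ 2) * ∑ k, y k ω ^ 2 :=
          Finset.sum_mul_sq_le_sq_mul_sq _ _ _
      _ ≤ ∑ _k : ι, T ^ 2 := by
          rw [hu, one_mul]
          exact Finset.sum_le_sum fun k _ => sq_le_sq' (_root_.abs_le.1 (hy.abs_le k ω)).1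
            (_root_.abs_le.1 (hy.abs_le k ω)).2
      _ = _ := by simp
  rw [abs_mul, abs_pow]
  calc |∑ k, u k * y k ω| ^ 3 * |y l ω| ≤ (√(Fintype.card ι) * T) ^ 3 * T := by
        gcongr
        exact hy.abs_le l ω
    _ = _ := by ring

lemma indepFun_sum (hy : BoundedIndep P y T m) (u : ι → ℝ) {s : Finset ι} {k : ι}
    (hk : k ∉ s) : IndepFun (fun ω => ∑ i ∈ s, u i * y i ω) (y k) P := by
  classical
  have h := hy.indep.indepFun_finset s {k} (Finset.disjoint_singleton_right.2 hk) hy.measurable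
  have hψ : Measurable fun z : ({k} : Finset ι) → ℝ => z ⟨k, Finset.mem_singleton_self k⟩ :=
    measurable_pi_apply _
  have h2 := h.comp (φ := fun z : s → ℝ => ∑ i : s, u i * z i)
    (ψ := fun z : ({k} : Finset ι) → ℝ => z ⟨k, Finset.mem_singleton_self k⟩)
    (Finset.measurable_sum _ fun i _ => (measurable_pi_apply i).const_mul _)
    hψ
  convert h2 using 1
  swap
  · rfl
  ext ω
  exact (Finset.sum_coe_sort s fun i => u i * y i ω).symm

variable [IsProbabilityMeasure P]

lemma integral_sum_cons (hy : BoundedIndep P y T m) (u : ι → ℝ) {s : Finset ι} {k : ι}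
    (hk : k ∉ s) (j l : ℕ) :
    ∫ ω, (∑ i ∈ s, u i * y i ω + u k * y k ω) ^ j * y k ω ^ l ∂P
      = ∑ i ∈ Finset.range (j + 1), (j.choose i * u k ^ (j - i)) *
        ((∫ ω, (∑ i ∈ s, u i * y i ω) ^ i ∂P) * m (j - i + l)) := by
  rw [integral_add_pow_mul_pow (hy.measurable_sum u s) (hy.measurable k) (hy.indepFun_sum u hk)
    (hy.abs_sum_le u s) (hy.abs_le k)]
  simp only [hy.moment]

lemma integral_sum_sq (hy : BoundedIndep P y T m) (h1 : m 1 = 0) (u : ι → ℝ) (s : Finset ι) :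
    ∫ ω, (∑ k ∈ s, u k * y k ω) ^ 2 ∂P = m 2 * ∑ k ∈ s, u k ^ 2 := by
  classical
  induction s using Finset.induction_on with
  | empty => simp
  | insert k s hk ih =>
    have := hy.integral_sum_cons u hk 2 0
    simp only [Finset.sum_range_succ, Finset.sum_range_zero, pow_zero, mul_one, ih] at this
    simp only [Finset.sum_insert hk, add_comm (u k * _), this]
    simp [h1]
    have : m 0 = 1 := by rw [← hy.moment k 0]; simp
    rw [this]
    ring

/-- Even moments of a linear combination are at most `θ` times the Gaussian ones. -/
lemma integral_sum_pow_le (hy : BoundedIndep P y T m) {θ : ℝ} (hθ1 : θ ≤ 1)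
    (h1 : m 1 = 0) (h3 : m 3 = 0) (h5 : m 5 = 0) (h7 : m 7 = 0)
    (h2 : m 2 ≤ θ) (h4 : m 4 ≤ 3 * θ) (h6 : m 6 ≤ 15 * θ) (h8 : m 8 ≤ 105 * θ)
    (u : ι → ℝ) (s : Finset ι) :
    ∫ ω, (∑ k ∈ s, u k * y k ω) ^ 4 ∂P ≤ 3 * θ * (∑ k ∈ s, u k ^ 2) ^ 2 ∧
    ∫ ω, (∑ k ∈ s, u k * y k ω) ^ 6 ∂P ≤ 15 * θ * (∑ k ∈ s, u k ^ 2) ^ 3 ∧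
    ∫ ω, (∑ k ∈ s, u k * y k ω) ^ 8 ∂P ≤ 105 * θ * (∑ k ∈ s, u k ^ 2) ^ 4 := by
  classical
  induction s using Finset.induction_on with
  | empty => simp
  | insert k s hk ih =>
    obtain ⟨ih4, ih6, ih8⟩ := ih
    have ih2 := hy.integral_sum_sq h1 u s
    have h0 : m 0 = 1 := by rw [← hy.moment k 0]; simp
    have m2 : 0 ≤ m 2 := by rw [← hy.moment k 2]; exact integral_nonneg fun _ => by positivity
    have m4 : 0 ≤ m 4 := by
      rw [← hy.moment k 4]; exact integral_nonneg fun _ => (by decide : Even 4).pow_nonneg _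
    have m6 : 0 ≤ m 6 := by
      rw [← hy.moment k 6]; exact integral_nonneg fun _ => (by decide : Even 6).pow_nonneg _
    have e4 := hy.integral_sum_cons u hk 4 0
    have e6 := hy.integral_sum_cons u hk 6 0
    have e8 := hy.integral_sum_cons u hk 8 0
    simp only [Finset.sum_range_succ, Finset.sum_range_zero, pow_zero, mul_one] at e4 e6 e8
    simp only [Finset.sum_insert hk, add_comm (u k * y k _), e4, e6, e8]
    -- Only even powers of the new variable survive. Since θ ≤ 1, one factor θ may be dropped from
    -- each product of two moments; the binomial coefficients times the Gaussian moments then equal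
    -- those of 3(q + v²)², 15(q + v²)³ and 105(q + v²)⁴.
    norm_num [Nat.choose, h0, h1, h3, h5, h7]
    set S2 := ∫ ω, (∑ k ∈ s, u k * y k ω) ^ 2 ∂P
    set S4 := ∫ ω, (∑ k ∈ s, u k * y k ω) ^ 4 ∂P
    set S6 := ∫ ω, (∑ k ∈ s, u k * y k ω) ^ 6 ∂P
    set S8 := ∫ ω, (∑ k ∈ s, u k * y k ω) ^ 8 ∂P
    set q := ∑ k ∈ s, u k ^ 2 with hq
    have hq0 : 0 ≤ q := Finset.sum_nonneg fun _ _ => sq_nonneg _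
    have hS2 : S2 ≤ θ * q := by rw [ih2]; gcongr
    have hS2' : S2 ≤ q := hS2.trans (mul_le_of_le_one_left hq0 hθ1)
    have hS4' : S4 ≤ 3 * q ^ 2 := ih4.trans (by
      have := mul_le_of_le_one_left (sq_nonneg q) hθ1; linarith)
    have hS6' : S6 ≤ 15 * q ^ 3 := ih6.trans (by
      have := mul_le_of_le_one_left (pow_nonneg hq0 3) hθ1; linarith)
    have hS20 : 0 ≤ S2 := integral_nonneg fun _ => by positivity
    have t22 : S2 * m 2 ≤ q * θ := by gcongr
    have t42 : S4 * m 2 ≤ 3 * q ^ 2 * θ := by gcongr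
    have t24 : S2 * m 4 ≤ q * (3 * θ) := by gcongr
    have t62 : S6 * m 2 ≤ 15 * q ^ 3 * θ := by gcongr
    have t44 : S4 * m 4 ≤ 3 * q ^ 2 * (3 * θ) := by gcongr
    have t26 : S2 * m 6 ≤ q * (15 * θ) := by gcongr
    set v := u k
    have v2 : 0 ≤ v ^ 2 := sq_nonneg v
    have v4 : 0 ≤ v ^ 4 := by positivity
    have v6 : 0 ≤ v ^ 6 := by positivity
    have v8 : 0 ≤ v ^ 8 := by positivity
    refine ⟨?_, ?_, ?_⟩
    · have a1 := mul_le_mul_of_nonneg_left t22 v2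
      have a2 := mul_le_mul_of_nonneg_left h4 v4
      linarith
    · have a1 := mul_le_mul_of_nonneg_left t42 v2
      have a2 := mul_le_mul_of_nonneg_left t24 v4
      have a3 := mul_le_mul_of_nonneg_left h6 v6
      linarith
    · have a1 := mul_le_mul_of_nonneg_left t62 v2
      have a2 := mul_le_mul_of_nonneg_left t44 v4
      have a3 := mul_le_mul_of_nonneg_left t26 v6
      have a4 := mul_le_mul_of_nonneg_left h8 v8
      linarith

variable [Fintype ι]

/-- After splitting off the l-th variable only 3u_l m₂²(1 - u_l²) + u_l³ m₄ survives. For m₂ = θ, m₄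
= 3θ these are the entries of `meanCubeGram`. -/
lemma integral_cube_mul (hy : BoundedIndep P y T m) (h1 : m 1 = 0)
    {u : ι → ℝ} (hu : ∑ k, u k ^ 2 = 1) (l : ι) :
    ∫ ω, (∑ k, u k * y k ω) ^ 3 * y l ω ∂P
      = (m 4 - 3 * m 2 ^ 2) * u l ^ 3 + 3 * m 2 ^ 2 * u l := by
  classical
  have h := hy.integral_sum_cons u (Finset.notMem_erase l Finset.univ) 3 1
  have hs : ∑ k ∈ Finset.univ.erase l, u k ^ 2 = 1 - u l ^ 2 := by
    rw [← hu, ← Finset.sum_erase_add _ _ (Finset.mem_univ l)]; ring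
  have hs1 : ∫ ω, ∑ k ∈ Finset.univ.erase l, u k * y k ω ∂P = 0 := by
    rw [integral_finsetSum _ fun k _ =>
      (integrable_of_abs_le (hy.measurable k) (hy.abs_le k)).const_mul _]
    refine Finset.sum_eq_zero fun k _ => ?_
    have := hy.moment k 1
    simp only [pow_one] at this
    rw [integral_const_mul, this, h1, mul_zero]
  simp only [Finset.sum_range_succ, Finset.sum_range_zero, hy.integral_sum_sq h1, hs, pow_one,
    hs1, Finset.sum_erase_add _ _ (Finset.mem_univ l)] at h
  rw [h]
  norm_num [Nat.choose, h1]
  ring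

lemma integral_sq_cube_mul_le (hy : BoundedIndep P y T m) {θ : ℝ} (hθ1 : θ ≤ 1)
    (h1 : m 1 = 0) (h3 : m 3 = 0) (h5 : m 5 = 0) (h7 : m 7 = 0)
    (h2 : m 2 ≤ θ) (h4 : m 4 ≤ 3 * θ) (h6 : m 6 ≤ 15 * θ) (h8 : m 8 ≤ 105 * θ)
    {u : ι → ℝ} (hu : ∑ k, u k ^ 2 = 1) (l : ι) :
    ∫ ω, ((∑ k, u k * y k ω) ^ 3 * y l ω) ^ 2 ∂P ≤ 105 * θ := by
  have hS := (hy.integral_sum_pow_le hθ1 h1 h3 h5 h7 h2 h4 h6 h8 u Finset.univ).2.2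
  rw [hu, one_pow, mul_one] at hS
  -- Young's inequality a⁶b² ≤ ¾a⁸ + ¼b⁸ reduces to eighth moments, each at most 105θ.
  have hpt : ∀ a b : ℝ, (a ^ 3 * b) ^ 2 ≤ 3 / 4 * a ^ 8 + 1 / 4 * b ^ 8 := by
    intro a b
    nlinarith [mul_nonneg (sq_nonneg (a ^ 2 - b ^ 2))
      (by positivity : 0 ≤ 3 * (a ^ 2) ^ 2 + 2 * a ^ 2 * b ^ 2 + (b ^ 2) ^ 2)]
  have hpow : ∀ {h : Ω → ℝ} {c : ℝ}, (∀ ω, |h ω| ≤ c) → ∀ (i : ℕ) ω, |h ω ^ i| ≤ c ^ i := by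
    intro h c hc i ω
    rw [abs_pow]
    exact pow_le_pow_left₀ (abs_nonneg _) (hc ω) i
  have i1 : Integrable (fun ω => 3 / 4 * (∑ k, u k * y k ω) ^ 8) P :=
    (integrable_of_abs_le ((hy.measurable_sum u _).pow_const 8)
      (hpow (hy.abs_sum_le u _) 8)).const_mul _
  have i2 : Integrable (fun ω => 1 / 4 * y l ω ^ 8) P :=
    (integrable_of_abs_le ((hy.measurable l).pow_const 8) (hpow (hy.abs_le l) 8)).const_mul _
  refine (integral_mono_of_nonneg (.of_forall fun ω => sq_nonneg _) (i1.add i2)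
    (.of_forall fun ω => hpt _ _)).trans ?_
  simp only [Pi.add_apply]
  rw [integral_add i1 i2, integral_const_mul, integral_const_mul, hy.moment]
  linarith

end BoundedIndep

end ColumnMoments

/-! ### Bernstein's inequality. -/

section Bernstein

open Real

lemma exp_le_one_add_add_sq {x : ℝ} (hx : |x| ≤ 1) : exp x ≤ 1 + x + x ^ 2 := by
  have := (abs_le.1 (abs_exp_sub_one_sub_id_le hx)).2
  linarith

/-- A Bernstein inequality for independent bounded summands. -/
lemma measure_sum_ge_le_exp {κ E : Type*} [Fintype κ] [MeasurableSpace E] (γ : Measure E)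
    [IsProbabilityMeasure γ] {Z : κ → E → ℝ} (hZ : ∀ c, Measurable (Z c)) {M v τ : ℝ}
    (hM : ∀ c x, |Z c x| ≤ M) (hv : 0 < v) (hZv : ∀ c, ∫ x, Z c x ^ 2 ∂γ ≤ v) (hM0 : 0 ≤ M)
    (hτ : 0 < τ) :
    (Measure.pi fun _ : κ => γ).real
        {x | ∑ c, ∫ x, Z c x ∂γ + Fintype.card κ * τ ≤ ∑ c, Z c (x c)}
      ≤ exp (-(Fintype.card κ * τ ^ 2 / (4 * v + 2 * M * τ))) := by
  -- This choice forces tM ≤ 1, the range where exp x ≤ 1 + x + x² is used. No centering is done: v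
  -- bounds the raw second moment.
  set t := τ / (2 * v + M * τ) with ht
  have hD : 0 < 2 * v + M * τ := by positivity
  have ht0 : 0 < t := by positivity
  have htM : t * M ≤ 1 := by
    rw [ht, div_mul_eq_mul_div, div_le_one hD]; linarith [mul_comm τ M]
  have hbd : ∀ c x, |t * Z c x| ≤ 1 := by
    intro c x
    rw [abs_mul, abs_of_pos ht0]
    exact (mul_le_mul_of_nonneg_left (hM c x) ht0.le).trans htM
  have hmgf : ∀ c, mgf (Z c) γ t ≤ exp (t * ∫ x, Z c x ∂γ + t ^ 2 * v) := by
    intro c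
    have i1 : Integrable (Z c) γ := integrable_of_abs_le (hZ c) (hM c)
    have i2 : Integrable (fun x => Z c x ^ 2) γ :=
      integrable_of_abs_le (c := M ^ 2) ((hZ c).pow_const 2) fun x => by
        rw [abs_pow]; exact pow_le_pow_left₀ (abs_nonneg _) (hM c x) 2
    have i0 : Integrable (fun x => 1 + t * Z c x) γ := (integrable_const 1).add (i1.const_mul t)
    have i3 : Integrable (fun x => 1 + t * Z c x + t ^ 2 * Z c x ^ 2) γ := i0.add (i2.const_mul _)
    calc mgf (Z c) γ t ≤ ∫ x, (1 + t * Z c x + t ^ 2 * Z c x ^ 2) ∂γ := by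
          refine integral_mono_of_nonneg (.of_forall fun x => (exp_pos _).le) i3
            (.of_forall fun x => ?_)
          have := exp_le_one_add_add_sq (hbd c x)
          rwa [mul_pow] at this
      _ = 1 + t * ∫ x, Z c x ∂γ + t ^ 2 * ∫ x, Z c x ^ 2 ∂γ := by
          rw [integral_add i0 (i2.const_mul _),
            integral_add (integrable_const 1) (i1.const_mul t), integral_const_mul,
            integral_const_mul]
          simp
      _ ≤ t * ∫ x, Z c x ∂γ + t ^ 2 * v + 1 := by
          have := mul_le_mul_of_nonneg_left (hZv c) (sq_nonneg t)
          linarith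
      _ ≤ _ := add_one_le_exp _
  set ν := Measure.pi fun _ : κ => γ with hν
  have hmeas : ∀ c, Measurable fun x : κ → E => Z c (x c) := fun c =>
    (hZ c).comp (measurable_pi_apply c)
  have hind : iIndepFun (fun c (x : κ → E) => Z c (x c)) ν :=
    iIndepFun_pi fun c => (hZ c).aemeasurable
  have hmgfν : ∀ c, mgf (fun x : κ → E => Z c (x c)) ν t = mgf (Z c) γ t := by
    intro c
    have hmp := measurePreserving_eval (fun _ : κ => γ) c
    rw [mgf, mgf, ← hmp.map_eq, integral_map hmp.measurable.aemeasurable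
      ((hZ c).const_mul t).exp.aestronglyMeasurable]
  have hsum : mgf (fun x : κ → E => ∑ c, Z c (x c)) ν t
      ≤ exp (t * ∑ c, ∫ x, Z c x ∂γ + Fintype.card κ * (t ^ 2 * v)) := by
    have h1 := hind.mgf_sum hmeas Finset.univ (t := t)
    have h2 : (∑ c, fun x : κ → E => Z c (x c)) = fun x => ∑ c, Z c (x c) := by
      ext x; simp
    rw [h2] at h1
    rw [h1]
    simp only [hmgfν]
    refine (Finset.prod_le_prod (fun c _ => mgf_nonneg) fun c _ => hmgf c).trans ?_
    rw [← exp_sum, Finset.sum_add_distrib, ← Finset.mul_sum]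
    simp
  have hint : Integrable (fun x : κ → E => exp (t * ∑ c, Z c (x c))) ν := by
    refine integrable_of_abs_le (c := exp (Fintype.card κ))
      ((Finset.measurable_sum _ fun c _ => hmeas c).const_mul t).exp fun x => ?_
    rw [abs_exp, exp_le_exp, Finset.mul_sum]
    refine (Finset.sum_le_sum fun c _ => (abs_le.1 (hbd c (x c))).2).trans ?_
    simp
  refine (measure_ge_le_exp_mul_mgf _ ht0.le hint).trans
    ((mul_le_mul_of_nonneg_left hsum (exp_pos _).le).trans ?_)
  rw [← exp_add, exp_le_exp]
  have hkey : τ ^ 2 / (4 * v + 2 * M * τ) ≤ t * τ - t ^ 2 * v := by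
    have e1 : t * τ - t ^ 2 * v = τ ^ 2 * (v + M * τ) / (2 * v + M * τ) ^ 2 := by
      rw [ht]; field_simp; ring
    rw [e1, div_le_div_iff₀ (by positivity) (by positivity)]
    have : 0 ≤ τ ^ 2 * (M * τ) * (2 * v + M * τ) := by positivity
    nlinarith
  have := mul_le_mul_of_nonneg_left hkey (Nat.cast_nonneg (Fintype.card κ) : (0 : ℝ) ≤ _)
  rw [mul_div_assoc]
  linarith

end Bernstein

/-! ### Product law of the columns and concentration of one Gram entry. -/

section Concentration

open Real

variable {n N : ℕ} {p : Fin N → ℕ}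

/-- Both sides make the entries i.i.d., so they agree after flattening the two indices into one;
currying transports this back. The column law then lives on a product space, where Bernstein applies
column by column. -/
lemma map_columns_eq_pi {Ω : Type*} [MeasurableSpace Ω] {μ : Measure Ω} {θ : ℝ} (hθ : 0 ≤ θ)
    (hθ1 : θ ≤ 1) {X : (i : Fin N) → Ω → Matrix (Fin n) (Fin (p i)) ℝ}
    (hX : IsIIDBernoulliGaussian μ θ X) :
    AEMeasurable (fun ω (c : Σ i, Fin (p i)) (j : Fin n) => X c.1 ω j c.2) μ ∧
    μ.map (fun ω (c : Σ i, Fin (p i)) (j : Fin n) => X c.1 ω j c.2)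
      = Measure.pi fun _ => Measure.pi fun _ => bernoulliGaussian θ := by
  have := isProbabilityMeasure_bernoulliGaussian hθ hθ1
  set Q : Measure ((Σ i, Fin (p i)) → Fin n → ℝ) :=
    Measure.pi fun _ => Measure.pi fun _ => bernoulliGaussian θ with hQ
  have hmeas : ∀ q : (Σ i, Fin (p i)) × Fin n,
      AEMeasurable (fun ω => X q.1.1 ω q.2 q.1.2) μ := fun q => (hX.1 _ _ _).aemeasurable
  have hind : iIndepFun (fun (q : (Σ i, Fin (p i)) × Fin n) ω => X q.1.1 ω q.2 q.1.2) μ := by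
    refine hX.2.precomp (g := fun q : (Σ i, Fin (p i)) × Fin n =>
      (⟨q.1.1, (q.2, q.1.2)⟩ : Σ i, Fin n × Fin (p i))) ?_
    rintro ⟨⟨i, k⟩, j⟩ ⟨⟨i', k'⟩, j'⟩ h
    simp only [Sigma.mk.injEq] at h
    obtain ⟨rfl, h⟩ := h
    simp only [heq_eq_eq, Prod.mk.injEq] at h
    simp [h.1, h.2]
  have h1 := hind.map_fun_eq_pi_map hmeas
  have h1' : ∀ q : (Σ i, Fin (p i)) × Fin n,
      μ.map (fun ω => X q.1.1 ω q.2 q.1.2) = bernoulliGaussian θ := fun q => (hX.1 _ _ _).map_eq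
  simp only [h1'] at h1
  have hQcol : ∀ c, Q.map (fun z => z c) = Measure.pi fun _ => bernoulliGaussian θ := fun c =>
    (measurePreserving_eval _ c).map_eq
  have hQind : iIndepFun (fun (q : (Σ i, Fin (p i)) × Fin n) z => z q.1 q.2) Q := by
    refine iIndepFun_uncurry' (X := fun c j (z : (Σ i, Fin (p i)) → Fin n → ℝ) => z c j)
      (fun c j => by fun_prop) ?_ fun c => ?_
    · exact iIndepFun_pi (X := fun _ (x : Fin n → ℝ) => x) fun _ => aemeasurable_id
    · rw [iIndepFun_iff_map_fun_eq_pi_map fun j => (by fun_prop :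
        Measurable fun z : (Σ i, Fin (p i)) → Fin n → ℝ => z c j).aemeasurable]
      have h3 : ∀ j, Q.map (fun z => z c j) = bernoulliGaussian θ := by
        intro j
        have : Q.map (fun z => z c j) = (Q.map fun z => z c).map fun x => x j := by
          rw [Measure.map_map (by fun_prop) (by fun_prop)]; rfl
        rw [this, hQcol]
        exact (measurePreserving_eval _ j).map_eq
      simp only [h3]
      exact hQcol c
  have h2 := hQind.map_fun_eq_pi_map fun (q : (Σ i, Fin (p i)) × Fin n) =>
    (by fun_prop : Measurable fun z : (Σ i, Fin (p i)) → Fin n → ℝ => z q.1 q.2).aemeasurable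
  have h2' : ∀ q : (Σ i, Fin (p i)) × Fin n, Q.map (fun z => z q.1 q.2) = bernoulliGaussian θ := by
    intro q
    have : Q.map (fun z => z q.1 q.2) = (Q.map fun z => z q.1).map fun x => x q.2 := by
      rw [Measure.map_map (by fun_prop) (by fun_prop)]; rfl
    rw [this, hQcol]
    exact (measurePreserving_eval _ q.2).map_eq
  simp only [h2'] at h2
  have hcurry : Measurable fun (w : (Σ i, Fin (p i)) × Fin n → ℝ) (c : Σ i, Fin (p i)) (j : Fin n)
      => w (c, j) := by fun_prop
  have hF : AEMeasurable (fun ω (q : (Σ i, Fin (p i)) × Fin n) => X q.1.1 ω q.2 q.1.2) μ :=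
    aemeasurable_pi_iff.2 hmeas
  refine ⟨hcurry.comp_aemeasurable hF, ?_⟩
  have h3 := AEMeasurable.map_map_of_aemeasurable hcurry.aemeasurable hF
  have h4 := Measure.map_map (μ := Q) (f := fun z (q : (Σ i, Fin (p i)) × Fin n) => z q.1 q.2)
    hcurry (by fun_prop)
  rw [h1] at h3
  rw [h2, h3] at h4
  exact h4.trans Measure.map_id

lemma boundedIndep_trunc {T θ : ℝ} (hT : 0 ≤ T) (hθ : 0 ≤ θ) (hθ1 : θ ≤ 1) :
    BoundedIndep (Measure.pi fun _ : Fin n => bernoulliGaussian θ) (fun k x => trunc T (x k)) T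
      (truncMoment T θ) := by
  have := isProbabilityMeasure_bernoulliGaussian hθ hθ1
  refine ⟨fun k => (measurable_trunc T).comp (measurable_pi_apply k),
    iIndepFun_pi fun _ => (measurable_trunc T).aemeasurable,
    fun k x => abs_trunc_le hT _, fun k j => ?_⟩
  have hmp := measurePreserving_eval (fun _ : Fin n => bernoulliGaussian θ) k
  have h := integral_map (μ := Measure.pi fun _ : Fin n => bernoulliGaussian θ)
    (f := fun x => trunc T x ^ j) hmp.measurable.aemeasurable
    ((measurable_trunc T).pow_const j).aestronglyMeasurable
  rw [hmp.map_eq] at h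
  exact h.symm

/-- `∑ᵢ (Vᵢ Zᵢ)^{∘3} Zᵢᵀ` for data `z` given as a family of columns. -/
noncomputable def columnGram (V : Fin N → Matrix (Fin n) (Fin n) ℝ)
    (z : (Σ i, Fin (p i)) → Fin n → ℝ) : Matrix (Fin n) (Fin n) ℝ :=
  Matrix.of fun j l => ∑ c, (∑ k, V c.1 j k * z c k) ^ 3 * z c l

lemma sum_cubeGram_eq_columnGram (V : Fin N → Matrix (Fin n) (Fin n) ℝ)
    (X : (i : Fin N) → Matrix (Fin n) (Fin (p i)) ℝ) :
    ∑ i, cubeGram (V i) (X i) = columnGram V fun c j => X c.1 j c.2 := by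
  ext j l
  rw [Matrix.sum_apply, columnGram, Matrix.of_apply, Fintype.sum_sigma]
  rfl

lemma cubeGram_concat_eq_columnGram (U : Matrix (Fin n) (Fin n) ℝ)
    (X : (i : Fin N) → Matrix (Fin n) (Fin (p i)) ℝ) :
    cubeGram U (concat X) = columnGram (fun _ => U) fun c j => X c.1 j c.2 := rfl

/-- The entries of the mean for truncated data are close to those for the original data. -/
lemma abs_truncated_mean_sub_le {T θ v : ℝ} (hT : 0 ≤ T) (hθ : 0 ≤ θ) (hθ1 : θ ≤ 1)
    (hv : |v| ≤ 1) :
    |(truncMoment T θ 4 - 3 * truncMoment T θ 2 ^ 2) * v ^ 3 + 3 * truncMoment T θ 2 ^ 2 * v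
      - (3 * θ * (1 - θ) * v ^ 3 + 3 * θ ^ 2 * v)| ≤ 72 * exp 2 * exp (-T) := by
  have l2 := le_truncMoment_even hT hθ hθ1 two_ne_zero even_two
  have l4 := le_truncMoment_even hT hθ hθ1 four_ne_zero (by decide : Even 4)
  have u2 := truncMoment_even_le hT hθ hθ1 two_ne_zero even_two
  have u4 := truncMoment_even_le hT hθ hθ1 four_ne_zero (by decide : Even 4)
  have n2 := truncMoment_even_nonneg T θ even_two
  rw [integral_sq_gaussianReal] at l2 u2
  rw [integral_pow_four_gaussianReal] at l4 u4
  norm_num [Nat.factorial] at l2 l4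
  set m2 := truncMoment T θ 2
  set m4 := truncMoment T θ 4
  set e := exp 2 * exp (-T) with he
  have he0 : 0 ≤ e := by positivity
  have hθe : θ * e ≤ e := mul_le_of_le_one_left he0 hθ1
  have d2 : θ - m2 ≤ 4 * e := by
    have : θ * (4 * exp 2 * exp (-T)) = 4 * (θ * e) := by rw [he]; ring
    linarith
  have d4 : 3 * θ - m4 ≤ 48 * e := by
    have : θ * (48 * exp 2 * exp (-T)) = 48 * (θ * e) := by rw [he]; ring
    linarith
  -- θ² - m₂² = (θ - m₂)(θ + m₂) with θ + m₂ ≤ 2. The total is 48 + 3·8 = 72.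
  have d2' : θ ^ 2 - m2 ^ 2 ≤ 8 * e := by nlinarith
  have d2n : 0 ≤ θ ^ 2 - m2 ^ 2 := by nlinarith
  have hv3 : |v ^ 3| ≤ 1 := by rw [abs_pow]; exact pow_le_one₀ (abs_nonneg _) hv
  have hv1 : |v * (1 - v ^ 2)| ≤ 1 := by
    rw [abs_mul]
    have : |1 - v ^ 2| ≤ 1 := by
      have := (sq_le_one_iff_abs_le_one v).2 hv
      rw [abs_le]; constructor <;> nlinarith [sq_nonneg v]
    exact mul_le_one₀ hv (abs_nonneg _) this
  have heq : (m4 - 3 * m2 ^ 2) * v ^ 3 + 3 * m2 ^ 2 * v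
      - (3 * θ * (1 - θ) * v ^ 3 + 3 * θ ^ 2 * v)
      = -((3 * θ - m4) * v ^ 3 + 3 * (θ ^ 2 - m2 ^ 2) * (v * (1 - v ^ 2))) := by ring
  rw [heq, abs_neg]
  refine (abs_add_le _ _).trans ?_
  rw [abs_mul, abs_mul, abs_of_nonneg (by linarith : 0 ≤ 3 * θ - m4),
    abs_of_nonneg (by linarith : 0 ≤ 3 * (θ ^ 2 - m2 ^ 2))]
  have a1 := mul_le_mul_of_nonneg_left hv3 (by linarith : 0 ≤ 3 * θ - m4)
  have a2 := mul_le_mul_of_nonneg_left hv1 (by linarith : 0 ≤ 3 * (θ ^ 2 - m2 ^ 2))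
  have : 72 * exp 2 * exp (-T) = 72 * e := by rw [he]; ring
  linarith

/-- Concentration of an entry of the Gram matrix of the truncated data around the true mean. -/
lemma measure_entry_deviation_le {T θ τ β : ℝ} (hT : 0 ≤ T) (hθ : 0 < θ) (hθ1 : θ ≤ 1)
    (hτ : 0 < τ) (hβ : 72 * exp 2 * exp (-T) ≤ β)
    {V : Fin N → Matrix (Fin n) (Fin n) ℝ} (hV : ∀ i, V i ∈ Matrix.orthogonalGroup (Fin n) ℝ)
    (j l : Fin n) :
    (Measure.pi fun _ : Σ i, Fin (p i) => Measure.pi fun _ : Fin n => bernoulliGaussian θ).real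
      {z | (∑ i, p i : ℕ) * (τ + β) < |columnGram V (fun c k => trunc T (z c k)) j l
        - (∑ i, (p i : ℝ) • meanCubeGram θ (V i)) j l|}
      ≤ 2 * exp (-((∑ i, p i : ℕ) * τ ^ 2 / (4 * (105 * θ) + 2 * (√n ^ 3 * T ^ 4) * τ))) := by
  have := isProbabilityMeasure_bernoulliGaussian hθ.le hθ1
  set γ := Measure.pi fun _ : Fin n => bernoulliGaussian θ with hγ
  have hy : BoundedIndep γ (fun k x => trunc T (x k)) T (truncMoment T θ) :=
    boundedIndep_trunc hT hθ.le hθ1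
  have hodd : ∀ {k : ℕ}, Odd k → truncMoment T θ k = 0 := truncMoment_odd hT hθ.le hθ1
  have m2 := truncMoment_even_le hT hθ.le hθ1 two_ne_zero even_two
  have m4 := truncMoment_even_le hT hθ.le hθ1 four_ne_zero (by decide : Even 4)
  have m6 := truncMoment_even_le hT hθ.le hθ1 (k := 6) (by decide) (by decide)
  have m8 := truncMoment_even_le hT hθ.le hθ1 (k := 8) (by decide) (by decide)
  rw [integral_sq_gaussianReal, mul_one] at m2
  rw [integral_pow_four_gaussianReal, mul_comm] at m4
  rw [integral_pow_six_gaussianReal, mul_comm] at m6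
  rw [integral_pow_eight_gaussianReal, mul_comm] at m8
  have hu : ∀ c : Σ i, Fin (p i), ∑ k, V c.1 j k ^ 2 = 1 := fun c =>
    sum_row_sq_of_orthogonal (hV c.1) j
  have hcard : (Fintype.card (Σ i, Fin (p i)) : ℝ) = (∑ i, p i : ℕ) := by simp
  -- The contribution of a column depends on its node through `V c.1`, but the bounds on size and
  -- second moment do not.
  set Z : (Σ i, Fin (p i)) → (Fin n → ℝ) → ℝ :=
    fun c x => (∑ k, V c.1 j k * trunc T (x k)) ^ 3 * trunc T (x l) with hZ
  have hZm : ∀ c, Measurable (Z c) := fun c =>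
    ((hy.measurable_sum (V c.1 j) Finset.univ).pow_const 3).mul (hy.measurable l)
  have hZM : ∀ c x, |Z c x| ≤ √n ^ 3 * T ^ 4 := fun c x => by
    have := hy.abs_cube_mul_le hT (hu c) l x
    rwa [Fintype.card_fin] at this
  have hZv : ∀ c, ∫ x, Z c x ^ 2 ∂γ ≤ 105 * θ := fun c =>
    hy.integral_sq_cube_mul_le hθ1 (hodd (by decide)) (hodd (by decide)) (hodd (by decide))
      (hodd (by decide)) m2 m4 m6 m8 (hu c) l
  have hZe : ∀ c, ∫ x, Z c x ∂γ = (truncMoment T θ 4 - 3 * truncMoment T θ 2 ^ 2) * V c.1 j l ^ 3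
      + 3 * truncMoment T θ 2 ^ 2 * V c.1 j l := fun c =>
    hy.integral_cube_mul (hodd (by decide)) (hu c) l
  have hmean : |∑ c, ∫ x, Z c x ∂γ - (∑ i, (p i : ℝ) • meanCubeGram θ (V i)) j l|
      ≤ (∑ i, p i : ℕ) * β := by
    have h1 : (∑ i, (p i : ℝ) • meanCubeGram θ (V i)) j l
        = ∑ c : Σ i, Fin (p i), (3 * θ * (1 - θ) * V c.1 j l ^ 3 + 3 * θ ^ 2 * V c.1 j l) := by
      rw [Matrix.sum_apply, Fintype.sum_sigma]
      simp [meanCubeGram, mul_add]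
    rw [h1, ← Finset.sum_sub_distrib, ← hcard]
    refine (Finset.abs_sum_le_sum_abs _ _).trans ?_
    refine (Finset.sum_le_card_nsmul _ _ β fun c _ => ?_).trans (by simp)
    rw [hZe]
    exact (abs_truncated_mean_sub_le hT hθ.le hθ1
      (apply_le_one_of_orthogonal (hV c.1) j l)).trans hβ
  have hM0 : 0 ≤ √n ^ 3 * T ^ 4 := by positivity
  have t1 := measure_sum_ge_le_exp γ hZm hZM (by positivity : 0 < 105 * θ) hZv hM0 hτ
  have t2 := measure_sum_ge_le_exp γ (Z := fun c x => -Z c x) (fun c => (hZm c).neg)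
    (fun c x => by rw [abs_neg]; exact hZM c x) (by positivity : 0 < 105 * θ)
    (fun c => by simpa only [neg_sq] using hZv c) hM0 hτ
  rw [hcard] at t1 t2
  rw [two_mul]
  refine le_trans (measureReal_mono ?_ (measure_ne_top _ _))
    ((measureReal_union_le _ _).trans (add_le_add t1 t2))
  intro z hz
  simp only [integral_neg, Finset.sum_neg_distrib]
  have hz' : (∑ i, p i : ℕ) * (τ + β) < |∑ c, Z c (z c)
      - (∑ i, (p i : ℝ) • meanCubeGram θ (V i)) j l| := hz
  have hm := abs_le.1 hmean
  rcases lt_abs.1 hz' with h | h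
  · left
    change ∑ c, ∫ x, Z c x ∂γ + (∑ i, p i : ℕ) * τ ≤ ∑ c, Z c (z c)
    linarith
  · right
    change -∑ c, ∫ x, Z c x ∂γ + (∑ i, p i : ℕ) * τ ≤ -∑ c, Z c (z c)
    linarith

end Concentration

/-! ### Union bound over entries and the final exponent. -/

section UnionBound

open Real

variable {n N : ℕ} {p : Fin N → ℕ}

lemma measureReal_exists_le {α ι : Type*} [Fintype ι] [MeasurableSpace α] (Q : Measure α)
    [IsFiniteMeasure Q] {A : ι → α → Prop} {c : ℝ} (h : ∀ i, Q.real {x | A i x} ≤ c) :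
    Q.real {x | ∃ i, A i x} ≤ Fintype.card ι * c := by
  have h1 : {x | ∃ i, A i x} = ⋃ i, {x | A i x} := by ext; simp
  rw [h1]
  refine (measureReal_iUnion_fintype_le _).trans ((Finset.sum_le_sum fun i _ => h i).trans ?_)
  simp

lemma measurePreserving_eval_eval {κ ι : Type*} [Fintype κ] [Fintype ι] (ν : Measure ℝ)
    [IsProbabilityMeasure ν] (c : κ) (k : ι) :
    MeasurePreserving (fun z : κ → ι → ℝ => z c k)
      (Measure.pi fun _ : κ => Measure.pi fun _ : ι => ν) ν := by
  have h1 := measurePreserving_eval (fun _ : κ => Measure.pi fun _ : ι => ν) c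
  have h2 := measurePreserving_eval (fun _ : ι => ν) k
  exact h2.comp h1

/-- Outside an event of small probability, the Gram matrices for two families of orthogonal
matrices are both close to their means. -/
lemma measure_gram_deviation_le {T θ τ β : ℝ} (hT : 0 ≤ T) (hθ : 0 < θ) (hθ1 : θ ≤ 1)
    (hτ : 0 < τ) (hβ : 72 * exp 2 * exp (-T) ≤ β)
    {V W : Fin N → Matrix (Fin n) (Fin n) ℝ} (hV : ∀ i, V i ∈ Matrix.orthogonalGroup (Fin n) ℝ)
    (hW : ∀ i, W i ∈ Matrix.orthogonalGroup (Fin n) ℝ) :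
    (Measure.pi fun _ : Σ i, Fin (p i) => Measure.pi fun _ : Fin n => bernoulliGaussian θ).real
      {z | ¬((∀ j l, |(columnGram V z - ∑ i, (p i : ℝ) • meanCubeGram θ (V i)) j l|
          ≤ (∑ i, p i : ℕ) * (τ + β)) ∧
        ∀ j l, |(columnGram W z - ∑ i, (p i : ℝ) • meanCubeGram θ (W i)) j l|
          ≤ (∑ i, p i : ℕ) * (τ + β))}
      ≤ 2 * n * (∑ i, p i : ℕ) * θ * exp (-T ^ 2 / 2) + 4 * (n : ℝ) ^ 2 *
        exp (-((∑ i, p i : ℕ) * τ ^ 2 / (4 * (105 * θ) + 2 * (√n ^ 3 * T ^ 4) * τ))) := by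
  have := isProbabilityMeasure_bernoulliGaussian hθ.le hθ1
  set q : ℝ := ((∑ i, p i : ℕ) : ℝ) with hq
  set Q := Measure.pi fun _ : Σ i, Fin (p i) => Measure.pi fun _ : Fin n => bernoulliGaussian θ
    with hQ
  set e := exp (-(q * τ ^ 2 / (4 * (105 * θ) + 2 * (√n ^ 3 * T ^ 4) * τ))) with he
  have hdev : ∀ {V : Fin N → Matrix (Fin n) (Fin n) ℝ},
      (∀ i, V i ∈ Matrix.orthogonalGroup (Fin n) ℝ) →
      Q.real {z | ∃ jl : Fin n × Fin n, q * (τ + β) <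
        |columnGram V (fun c k => trunc T (z c k)) jl.1 jl.2
          - (∑ i, (p i : ℝ) • meanCubeGram θ (V i)) jl.1 jl.2|} ≤ 2 * (n : ℝ) ^ 2 * e := by
    intro V hV
    have h : ∀ jl : Fin n × Fin n, Q.real {z | q * (τ + β) <
        |columnGram V (fun c k => trunc T (z c k)) jl.1 jl.2
          - (∑ i, (p i : ℝ) • meanCubeGram θ (V i)) jl.1 jl.2|} ≤ 2 * e := fun jl =>
      measure_entry_deviation_le hT hθ hθ1 hτ hβ hV jl.1 jl.2
    refine (measureReal_exists_le Q h).trans (le_of_eq ?_)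
    simp only [Fintype.card_prod, Fintype.card_fin, Nat.cast_mul]
    ring
  have hlarge : Q.real {z | ∃ ck : (Σ i, Fin (p i)) × Fin n, T < |z ck.1 ck.2|}
      ≤ 2 * n * q * θ * exp (-T ^ 2 / 2) := by
    have h : ∀ ck : (Σ i, Fin (p i)) × Fin n, Q.real {z | T < |z ck.1 ck.2|}
        ≤ 2 * θ * exp (-T ^ 2 / 2) := by
      intro ck
      have hmp := measurePreserving_eval_eval (bernoulliGaussian θ) ck.1 ck.2
      have hs : MeasurableSet {x : ℝ | T < |x|} :=
        measurableSet_lt measurable_const measurable_abs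
      have h := hmp.measureReal_preimage hs.nullMeasurableSet
      exact h.le.trans (bernoulliGaussian_tail_le hT hθ.le)
    refine (measureReal_exists_le Q h).trans (le_of_eq ?_)
    simp only [hq, Fintype.card_prod, Fintype.card_fin, Fintype.card_sigma, Nat.cast_mul]
    ring
  -- If no entry exceeds T, truncation changes nothing, so a single truncation event serves both
  -- families.
  have hsub := measureReal_mono (μ := Q) (s₁ := {z | ¬((∀ j l,
      |(columnGram V z - ∑ i, (p i : ℝ) • meanCubeGram θ (V i)) j l| ≤ q * (τ + β)) ∧
        ∀ j l, |(columnGram W z - ∑ i, (p i : ℝ) • meanCubeGram θ (W i)) j l| ≤ q * (τ + β))})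
    (s₂ := {z | ∃ ck : (Σ i, Fin (p i)) × Fin n, T < |z ck.1 ck.2|} ∪
      ({z | ∃ jl : Fin n × Fin n, q * (τ + β) <
        |columnGram V (fun c k => trunc T (z c k)) jl.1 jl.2
          - (∑ i, (p i : ℝ) • meanCubeGram θ (V i)) jl.1 jl.2|} ∪
      {z | ∃ jl : Fin n × Fin n, q * (τ + β) <
        |columnGram W (fun c k => trunc T (z c k)) jl.1 jl.2
          - (∑ i, (p i : ℝ) • meanCubeGram θ (W i)) jl.1 jl.2|}) ) ?_ (measure_ne_top _ _)
  · have h1 := hdev hV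
    have h2 := hdev hW
    refine hsub.trans ((measureReal_union_le _ _).trans ?_)
    have h3 := measureReal_union_le (μ := Q) {z | ∃ jl : Fin n × Fin n, q * (τ + β) <
        |columnGram V (fun c k => trunc T (z c k)) jl.1 jl.2
          - (∑ i, (p i : ℝ) • meanCubeGram θ (V i)) jl.1 jl.2|}
      {z | ∃ jl : Fin n × Fin n, q * (τ + β) <
        |columnGram W (fun c k => trunc T (z c k)) jl.1 jl.2
          - (∑ i, (p i : ℝ) • meanCubeGram θ (W i)) jl.1 jl.2|}
    linarith
  · intro z hz
    by_cases hl : ∃ ck : (Σ i, Fin (p i)) × Fin n, T < |z ck.1 ck.2|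
    · exact Or.inl hl
    right
    push Not at hl
    have hz0 : (fun c k => trunc T (z c k)) = z := by
      ext c k
      exact trunc_of_le (hl (c, k))
    by_contra hcon
    refine hz ⟨fun j l => ?_, fun j l => ?_⟩ <;> by_contra hlt <;> refine hcon ?_
    · exact Or.inl ⟨(j, l), by rw [hz0]; exact not_le.1 hlt⟩
    · exact Or.inr ⟨(j, l), by rw [hz0]; exact not_le.1 hlt⟩

/-- The Bernstein exponent at the deviation that the perturbation argument tolerates. -/
lemma exp_bernstein_le {n : ℕ} (hn : 0 < n) {q δ C θ L c₂ τ : ℝ} (hq : 0 ≤ q) (hδ : 0 < δ)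
    (hC : 0 < C) (hθ : 0 < θ) (hc₂ : 6.8 * 10 ^ 4 < c₂)
    (hτ : τ = 3 / 4 * (δ * C / (2 * (δ + 2) * n))) :
    exp (-(q * τ ^ 2 / (4 * (105 * θ) + 2 * (√n ^ 3 * L ^ 4) * τ)))
      ≤ exp (-3 * q * δ ^ 2 * C ^ 2 / (c₂ * (δ + 2) ^ 2 * (n : ℝ) ^ 2 * θ
        + 16 * (n : ℝ) ^ (5 / 2 : ℝ) * L ^ 4 * δ * (δ + 2) * C)) := by
  have hn0 : (0 : ℝ) < n := by exact_mod_cast hn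
  have hpow : (n : ℝ) ^ (5 / 2 : ℝ) = √n ^ 3 * n := by
    rw [sqrt_eq_rpow, ← rpow_natCast, ← rpow_mul hn0.le, ← rpow_add_one hn0.ne']
    norm_num
  set w := √(n : ℝ) ^ 3 with hw
  have hw0 : 0 ≤ w := by positivity
  -- Expanding by (64/3)(δ + 2)²n² turns 4·105 into 8960, which is below c₂. The factor 3/4 in τ
  -- makes the second coefficient exactly 16.
  have heq : q * τ ^ 2 / (4 * (105 * θ) + 2 * (w * L ^ 4) * τ)
      = 3 * q * δ ^ 2 * C ^ 2 / (8960 * (δ + 2) ^ 2 * (n : ℝ) ^ 2 * θ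
        + 16 * (w * n) * L ^ 4 * δ * (δ + 2) * C) := by
    have hE : 0 < δ + 2 := by linarith
    rw [div_eq_div_iff (by rw [hτ]; positivity) (by positivity), hτ]
    field_simp
    ring
  rw [hpow, exp_le_exp, heq]
  have hc : (8960 : ℝ) ≤ c₂ := by norm_num at hc₂; linarith
  have hle : 3 * q * δ ^ 2 * C ^ 2 / (c₂ * (δ + 2) ^ 2 * (n : ℝ) ^ 2 * θ
        + 16 * (w * n) * L ^ 4 * δ * (δ + 2) * C)
      ≤ 3 * q * δ ^ 2 * C ^ 2 / (8960 * (δ + 2) ^ 2 * (n : ℝ) ^ 2 * θ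
        + 16 * (w * n) * L ^ 4 * δ * (δ + 2) * C) := by
    gcongr
  have hneg : -3 * q * δ ^ 2 * C ^ 2 = -(3 * q * δ ^ 2 * C ^ 2) := by ring
  rw [hneg, neg_div]
  linarith

end UnionBound

/-! ### From iterates to polar factors of the Gram matrices. -/

section Step

variable {n N : ℕ} {p : Fin N → ℕ}

lemma cubeGram_mul_right {κ : Type*} [Fintype κ] (A D : Matrix (Fin n) (Fin n) ℝ)
    (X : Matrix (Fin n) κ ℝ) : cubeGram A (D * X) = cubeGram (A * D) X * Dᵀ := by
  rw [cubeGram, cubeGram, ← Matrix.mul_assoc, Matrix.transpose_mul, ← Matrix.mul_assoc]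

lemma concat_mul (D : Matrix (Fin n) (Fin n) ℝ) (X : (i : Fin N) → Matrix (Fin n) (Fin (p i)) ℝ) :
    concat (fun i => D * X i) = D * concat X := rfl

lemma norm_sub_le_deviation (A : Matrix (Fin n) (Fin n) ℝ)
    (B : Fin N → Matrix (Fin n) (Fin n) ℝ) (i : Fin N) : ‖A - B i‖ ≤ deviation A B :=
  le_ciSup (f := fun i => ‖A - B i‖) (Set.finite_range _).bddAbove i

lemma deviation_lt (hN : 0 < N) {A : Matrix (Fin n) (Fin n) ℝ}
    {B : Fin N → Matrix (Fin n) (Fin n) ℝ} {c : ℝ} (h : ∀ i, ‖A - B i‖ < c) :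
    deviation A B < c := by
  have : Nonempty (Fin N) := ⟨⟨0, hN⟩⟩
  obtain ⟨i, hi⟩ := exists_eq_ciSup_of_finite (f := fun i => ‖A - B i‖)
  rw [deviation, ← hi]
  exact h i

/-- The centralized step and the step with perfect consensus differ by at most the polar
perturbation bound for the two Gram matrices. -/
lemma norm_step_sub_le_polarRatio (hN : 0 < N) {D A A' Abar' : Matrix (Fin n) (Fin n) ℝ}
    (hD : D ∈ Matrix.orthogonalGroup (Fin n) ℝ) {V : Fin N → Matrix (Fin n) (Fin n) ℝ}
    {X : (i : Fin N) → Matrix (Fin n) (Fin (p i)) ℝ}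
    (hA : IsMSPStep (concat fun i => D * X i) A A')
    (hbar : IsPerfectDMSPStep (fun i => D * X i) V Abar')
    (hpos : 0 < sigmaMin (cubeGram (A * D) (concat X))
      + sigmaMin (∑ i, cubeGram (V i * D) (X i))) :
    ‖A' - Abar'‖ ≤ polarRatio (cubeGram (A * D) (concat X)) (∑ i, cubeGram (V i * D) (X i)) := by
  have hN0 : (0 : ℝ) < N := by exact_mod_cast hN
  rw [IsMSPStep, grad, concat_mul, cubeGram_mul_right] at hA
  have h1 := hA.mul_orthogonal (by norm_num) hD
  have h2 : (N : ℝ)⁻¹ • ∑ i, grad (V i) (D * X i)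
      = ((N : ℝ)⁻¹ * 4) • ((∑ i, cubeGram (V i * D) (X i)) * Dᵀ) := by
    simp only [grad, cubeGram_mul_right]
    rw [← Finset.smul_sum, smul_smul, Matrix.sum_mul]
  rw [IsPerfectDMSPStep, h2] at hbar
  have h3 := hbar.mul_orthogonal (by positivity) hD
  have h4 := h1.norm_sub_le_polarRatio h3 hpos
  rwa [← Matrix.sub_mul, norm_mul_orthogonal _ hD] at h4

end Step

/-! ### Consequences of the sample size condition. -/

section SampleSize

open Real

/-- The sample size condition forces more than one sample and makes the truncation bias small. -/
lemma bias_le_of_sample_size {q n : ℕ} (hn : 0 < n) {δ C : ℝ} (hδ : 0 < δ) (hC : 0 < C)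
    (h : 2880 * exp 2 * ((δ + 2) / (δ * C) * n) ≤ (q : ℝ) / log q ^ 4) :
    1 < q ∧ 72 * exp 2 * exp (-log q) ≤ 1 / 4 * (δ * C / (2 * (δ + 2) * n)) := by
  have hn0 : (0 : ℝ) < n := by exact_mod_cast hn
  have hpos : 0 < 2880 * exp 2 * ((δ + 2) / (δ * C) * n) := by positivity
  have hq : 1 < q := by
    by_contra hq
    have : q = 0 ∨ q = 1 := by omega
    -- For q ≤ 1 the logarithm is 0, and division by zero makes the right side of `h` equal to 0.
    rcases this with rfl | rfl <;> norm_num at h <;> linarith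
  refine ⟨hq, ?_⟩
  have hq0 : (0 : ℝ) < q := by exact_mod_cast (by omega : 0 < q)
  have hlog : 0.69 ≤ log q := by
    have h2 : log 2 ≤ log q := log_le_log (by norm_num) (by exact_mod_cast hq)
    have := log_two_gt_d9
    norm_num at this ⊢
    linarith
  -- The constant 2880 is 72·8/0.2: 72 from the bias, 8 from a quarter of the tolerance δC/(2(δ +
  -- 2)n).
  have hlog4 : 0.2 ≤ log q ^ 4 := by
    calc (0.2 : ℝ) ≤ 0.69 ^ 4 := by norm_num
      _ ≤ _ := pow_le_pow_left₀ (by norm_num) hlog 4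
  have hlogpos : 0 < log q ^ 4 := by linarith
  rw [le_div_iff₀ hlogpos] at h
  have h2 : 2880 * exp 2 * ((δ + 2) / (δ * C) * n) * 0.2 ≤ q :=
    (mul_le_mul_of_nonneg_left hlog4 hpos.le).trans h
  rw [exp_neg, exp_log hq0]
  have h3 : 2880 * exp 2 * ((δ + 2) / (δ * C) * n) * 0.2
      = (576 * exp 2 * ((δ + 2) * n)) / (δ * C) := by
    field_simp
    norm_num
  rw [h3, div_le_iff₀ (by positivity)] at h2
  have h4 : 1 / 4 * (δ * C / (2 * (δ + 2) * n)) = δ * C / (8 * ((δ + 2) * n)) := by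
    field_simp
    norm_num
  rw [h4, ← div_eq_mul_inv, div_le_div_iff₀ hq0 (by positivity)]
  linarith

end SampleSize

end DMSP

/-! ### Assembly. -/

theorem theorem4 :
    ∃ K : ℝ, 0 < K ∧
    ∀ (c₂ : ℝ), 6.8 * 10 ^ 4 < c₂ →
    ∀ (n N : ℕ) (p : Fin N → ℕ), 0 < N →
    ∀ (Ω : Type*) [MeasurableSpace Ω] (μ : Measure Ω) [IsProbabilityMeasure μ]
      (θ α ε : ℝ), 0 < θ → θ < α → α < 1 →
    -- the data `Y i = D₀ * X i`
    ∀ (D₀ : Matrix (Fin n) (Fin n) ℝ), D₀ ∈ Matrix.orthogonalGroup (Fin n) ℝ →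
    ∀ (X Y : (i : Fin N) → Ω → Matrix (Fin n) (Fin (p i)) ℝ),
      DMSP.IsIIDBernoulliGaussian μ θ X →
      (∀ i ω, Y i ω = D₀ * X i ω) →
    -- the network
    ∀ (E : ℕ → Fin N → Fin N → Prop) (W : ℕ → Matrix (Fin N) (Fin N) ℝ),
      DMSP.UniformlyStronglyConnected E → DMSP.IsWeights E W →
    -- the iterates at time `t`
    ∀ (A : Matrix (Fin n) (Fin n) ℝ) (Aᵢ : Fin N → Matrix (Fin n) (Fin n) ℝ),
      A ∈ Matrix.orthogonalGroup (Fin n) ℝ →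
      (∀ i, Aᵢ i ∈ Matrix.orthogonalGroup (Fin n) ℝ) →
    -- the iterates at time `t + 1`; the number of consensus iterations may depend on the data
    ∀ (A' Abar' : Ω → Matrix (Fin n) (Fin n) ℝ) (Aᵢ' : Ω → Fin N → Matrix (Fin n) (Fin n) ℝ)
      (Tc : Ω → ℕ),
      (∀ ω, DMSP.IsMSPStep (DMSP.concat fun i => Y i ω) A (A' ω)) →
      (∀ ω, DMSP.IsDMSPStep W (Tc ω) (fun i => Y i ω) Aᵢ (Aᵢ' ω)) →
      (∀ ω, DMSP.IsPerfectDMSPStep (fun i => Y i ω) Aᵢ (Abar' ω)) →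
    -- closeness to a signed permutation
    ∀ (P : Matrix (Fin n) (Fin n) ℝ), DMSP.IsSignedPermutation P →
      0 ≤ ε →
      ε < (α - θ) / (2 * α * n * (1 - θ) + 3 * √2 * (1 + α) * (1 - θ) + α * θ) →
      ‖A * D₀ - P‖ ≤ ε → (∀ i, ‖Aᵢ i * D₀ - P‖ ≤ ε) →
    ∀ (δ C : ℝ), δ = DMSP.deviation A Aᵢ → 0 < δ → C = DMSP.constC n α θ ε →
    -- the sample size
      K * ((δ + 2) / (δ * C) * n) ≤ ((∑ i, p i : ℕ) : ℝ) / Real.log ((∑ i, p i : ℕ) : ℝ) ^ 4 →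
    ∀ (B S : Ω → Matrix (Fin n) (Fin n) ℝ),
      (∀ ω, B ω = DMSP.cubeGram (A * D₀) (DMSP.concat fun i => X i ω)) →
      (∀ ω, S ω = ∑ i, DMSP.cubeGram (Aᵢ i * D₀) (X i ω)) →
    -- the consensus error is in the interval, whenever this is well defined and non-empty
      (∀ᵐ ω ∂μ, 0 < DMSP.sigmaMin (B ω) + DMSP.sigmaMin (S ω) →
        DMSP.polarRatio (B ω) (S ω) < α * δ →
        DMSP.deviation (Abar' ω) (Aᵢ' ω) ∈ Set.Ico 0 (α * δ - DMSP.polarRatio (B ω) (S ω))) →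
    DMSP.probBound n (∑ i, p i) θ δ C c₂
      ≤ μ.real {ω | DMSP.deviation (A' ω) (Aᵢ' ω) < α * δ} := by
  refine ⟨2880 * Real.exp 2, by positivity, ?_⟩
  intro c₂ hc₂ n N p hN Ω _ μ _ θ α ε hθ hθα hα D₀ hD X Y hX hY E W _ _ A Aᵢ hA hAᵢ A' Abar' Aᵢ' Tc
    hmsp _ hbar P hP hε0 hε hAP hAiP δ C hδdef hδ hCdef hsize B S hB hS hcons
  have hθ1 : θ ≤ 1 := by linarith
  have hn : 0 < n := by
    -- In dimension 0 all matrices coincide, which contradicts δ > 0.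
    rcases Nat.eq_zero_or_pos n with rfl | hn
    · exfalso
      have : DMSP.deviation A Aᵢ < δ := DMSP.deviation_lt hN fun i => by
        rw [Subsingleton.elim A (Aᵢ i), sub_self, norm_zero]; exact hδ
      exact absurd hδdef this.ne'
    · exact hn
  have hn0 : (0 : ℝ) < n := by exact_mod_cast hn
  have hC : 0 < C := hCdef ▸ DMSP.constC_pos hθ hθα hα hε
  obtain ⟨hp1, hbias⟩ := DMSP.bias_le_of_sample_size hn hδ hC hsize
  set q := ∑ i, p i with hq
  set T := Real.log (q : ℝ) with hT
  have hT0 : 0 ≤ T := Real.log_natCast_nonneg q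
  -- Tolerance per entry and per sample: the Frobenius norm is at most n times the largest entry, so
  -- n·q·s is the admissible r. Of s, 3/4 goes to fluctuation and 1/4 to truncation bias.
  set s := δ * C / (2 * (δ + 2) * n) with hs
  have hs0 : 0 < s := by positivity
  set U := A * D₀ with hUdef
  have hU : U ∈ Matrix.orthogonalGroup (Fin n) ℝ := mul_mem hA hD
  have hV : ∀ i, Aᵢ i * D₀ ∈ Matrix.orthogonalGroup (Fin n) ℝ := fun i => mul_mem (hAᵢ i) hD
  have hUV : ∀ i, ‖U - Aᵢ i * D₀‖ ≤ δ := fun i => by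
    rw [hUdef, ← Matrix.sub_mul, DMSP.norm_mul_orthogonal _ hD, hδdef]
    exact DMSP.norm_sub_le_deviation A Aᵢ i
  have htail := DMSP.measure_gram_deviation_le (p := p) hT0 hθ hθ1 (τ := 3 / 4 * s) (by positivity)
    hbias (V := fun _ => U) (W := fun i => Aᵢ i * D₀) (fun _ => hU) hV
  have hexp := DMSP.exp_bernstein_le hn (L := T) (Nat.cast_nonneg q) hδ hC hθ hc₂ rfl
  obtain ⟨hFm, hFmap⟩ := DMSP.map_columns_eq_pi hθ.le hθ1 hX
  set F : Ω → (Σ i, Fin (p i)) → Fin n → ℝ := fun ω c j => X c.1 ω j c.2 with hF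
  set bad : Set ((Σ i, Fin (p i)) → Fin n → ℝ) := {z | ¬((∀ j l,
    |(DMSP.columnGram (fun _ => U) z - ∑ i, (p i : ℝ) • DMSP.meanCubeGram θ U) j l|
      ≤ (q : ℝ) * (3 / 4 * s + 1 / 4 * s)) ∧
    ∀ j l, |(DMSP.columnGram (fun i => Aᵢ i * D₀) z
      - ∑ i, (p i : ℝ) • DMSP.meanCubeGram θ (Aᵢ i * D₀)) j l|
      ≤ (q : ℝ) * (3 / 4 * s + 1 / 4 * s))} with hbad
  have hgood : ∀ᵐ ω ∂μ, ω ∈ {ω | DMSP.deviation (A' ω) (Aᵢ' ω) < α * δ}ᶜ → ω ∈ F ⁻¹' bad := by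
    filter_upwards [hcons] with ω hω hnot
    by_contra hg
    refine hnot ?_
    have hg' : F ω ∉ bad := hg
    rw [hbad, Set.mem_ofPred_eq, not_not] at hg'
    have hBe : B ω = DMSP.columnGram (fun _ => U) (F ω) := by
      rw [hB, DMSP.cubeGram_concat_eq_columnGram]
    have hSe : S ω = DMSP.columnGram (fun i => Aᵢ i * D₀) (F ω) := by
      rw [hS, DMSP.sum_cubeGram_eq_columnGram]
    rw [← hBe, ← hSe] at hg'
    have hr : (n : ℝ) * ((q : ℝ) * (3 / 4 * s + 1 / 4 * s))
        = (q : ℝ) * (δ * DMSP.constC n α θ ε) / (2 * (δ + 2)) := by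
      rw [← hCdef, hs]; field_simp; ring
    have hrn : 0 ≤ (q : ℝ) * (3 / 4 * s + 1 / 4 * s) := by positivity
    obtain ⟨hpos, hlt⟩ := DMSP.polarRatio_lt_of_norm_sub_mean_le hn (by omega : 0 < ∑ i, p i)
      hθ hθα hα hU hV hP hε0 hε hAP hAiP hδ hUV hr
      (DMSP.norm_le_of_abs_le _ hrn hg'.1) (DMSP.norm_le_of_abs_le _ hrn hg'.2)
    have hdev := (hω hpos hlt).2
    have hYe : (fun i => Y i ω) = fun i => D₀ * X i ω := funext fun i => hY i ω
    have hstep := hmsp ω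
    have hstep' := hbar ω
    rw [hYe] at hstep hstep'
    rw [hB, hS] at hpos hdev
    have hpolar := DMSP.norm_step_sub_le_polarRatio hN hD hstep hstep' hpos
    refine DMSP.deviation_lt hN fun i => ?_
    have h1 := norm_sub_le_norm_sub_add_norm_sub (A' ω) (Abar' ω) (Aᵢ' ω i)
    have h2 := DMSP.norm_sub_le_deviation (Abar' ω) (Aᵢ' ω) i
    linarith
  have hQ : IsProbabilityMeasure (Measure.pi fun _ : Σ i, Fin (p i) =>
      Measure.pi fun _ : Fin n => DMSP.bernoulliGaussian θ) := by
    have := DMSP.isProbabilityMeasure_bernoulliGaussian hθ.le hθ1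
    infer_instance
  have hle : μ.real {ω | DMSP.deviation (A' ω) (Aᵢ' ω) < α * δ}ᶜ
      ≤ (Measure.pi fun _ : Σ i, Fin (p i) =>
        Measure.pi fun _ : Fin n => DMSP.bernoulliGaussian θ).real bad := by
    refine ENNReal.toReal_mono (measure_ne_top _ _) ?_
    rw [← hFmap]
    -- `Measure.le_map_apply` holds for arbitrary sets, so neither `bad` nor the iterates need be
    -- measurable. For the same reason complements are handled below by subadditivity.
    exact (measure_mono_ae hgood).trans (Measure.le_map_apply hFm bad)
  have hunion : 1 ≤ μ.real {ω | DMSP.deviation (A' ω) (Aᵢ' ω) < α * δ}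
      + μ.real {ω | DMSP.deviation (A' ω) (Aᵢ' ω) < α * δ}ᶜ := by
    refine le_trans (le_of_eq ?_) (measureReal_union_le _ _)
    rw [Set.union_compl_self, probReal_univ]
  -- The union bound gives constants 2 and 4; nonnegativity of the two terms (`h1`, `h4`) weakens
  -- both to 8.
  have h1 : 0 ≤ n * (q : ℝ) * θ * Real.exp (-T ^ 2 / 2) := by positivity
  have h2 := mul_le_mul_of_nonneg_left hexp (by positivity : 0 ≤ 4 * (n : ℝ) ^ 2)
  have h3 := hle.trans htail
  rw [DMSP.probBound]
  have h4 : 0 ≤ (n : ℝ) ^ 2 * Real.exp (-3 * q * δ ^ 2 * C ^ 2 /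
      (c₂ * (δ + 2) ^ 2 * (n : ℝ) ^ 2 * θ
        + 16 * (n : ℝ) ^ (5 / 2 : ℝ) * T ^ 4 * δ * (δ + 2) * C)) := by positivity
  linarith
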